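/- Consider $L$ sensors that share one time-slotted channel. In every slot, sensor $i$ takes a sample with probability $r_i>0$, independently of everything else. The measurement of sensor $i$ in slot $t$ has distribution $f_{0,i}$ if $t\le\nu$ and $f_{1,i}$ if $t>\nu$, where $\nu$ is the change point; measurements are independent across sensors and slots, and $f_{1,i}\ll f_{0,i}$, so that the log-likelihood ratios below are well defined. Each sensor keeps its samples in an infinite queue; a sample taken in slot $t$ can be sent from slot $t+1$ on. In each slot in which some queue is nonempty, a sensor is chosen uniformly at random among those with a nonempty queue and transmits one of its waiting samples, picked by an arbitrary fixed deterministic rule depending on the set of its waiting samples (e.g. first-come-first-served or last-come-first-served). The transmission succeeds with probability $p$, the same before and after the change, independently of everything else. A received sample leaves the queue and a failed one remains. Assume $\sum_i r_i<p\le 1$. For each slot let $Y\in\{1,0,\emptyset\}$ indicate a successful, a failed, or no transmission; if $Y=1$, let $U$ be the sensor, $J$ the sampling slot and $Z$ the value of the received measurement (unobserved otherwise). Let $\mathbb P_\nu$ be the law with change point $\nu$ (so under $\mathbb P_0$ all samples taken from slot $1$ on are post-change, and under $\mathbb P_\infty$ all samples are pre-change), given the vector $\boldsymbol Q_1$ of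 queue lengths at the beginning of slot $1$; the packets waiting then were sampled in slots $\le 0$, and the conditional law of their sampling slots is arbitrary and the same under all $\mathbb P_\nu$. Let $$l_{0,n}=\log\frac{d\mathbb P_0(U_1^n,Y_1^n,J_1^n,Z_1^n\mid \boldsymbol Q_1)}{d\mathbb P_\infty(U_1^n,Y_1^n,J_1^n,Z_1^n\mid \boldsymbol Q_1)}$$ be the log-likelihood ratio of the observations in slots $1,\dots,n$. Then: 1. The Markov chain of queue-length vectors has exactly one stationary distribution, and in steady state $$\mathbb P(Y=1)=\sum_{i=1}^L r_i,\qquad \mathbb P(U=i\mid Y=1)=\frac{r_i}{\sum_{j=1}^L r_j}\quad(1\le i\le L).$$ 2. For every value of $\boldsymbol Q_1$ the law of the observations in slots $1,\dots,n$ under $\mathbb P_0$ is absolutely continuous with respect to that under $\mathbb P_\infty$, for every $n$, and $\mathbb P_0$-almost surely the information rate $\bar I=\lim_{n\to\infty}\frac1n\,l_{0,n}$ exists and $$\bar I=\sum_{i=1}^L r_i\,D(f_{1,i}\,\|\,f_{0,i}),$$ where $D$ is the Kullback–Leibler divergence (if some $D(f_{1,i}\|f_{0,i})=\infty$, both sides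 are $+\infty$). -/

import Mathlib

open MeasureTheory ProbabilityTheory InformationTheory Filter Topology
open scoped ENNReal

/-- `L` sensors sharing one channel: sampling probabilities, packet success probability, pre- and
post-change distributions of each sensor, and the rule by which a sensor that has been granted the
channel picks one of its waiting samples. A waiting sample is named by the slot in which it was
taken; `discipline i s` is the sample picked by sensor `i` from the set `s` of waiting ones
(the minimum for FCFS, the maximum for LCFS). -/
structure SensorNetwork (L : ℕ) (E : Type*) [MeasurableSpace E] where
  rate : Fin L → unitInterval
  success : unitInterval
  pre : Fin L → ProbabilityMeasure E
  post : Fin L → ProbabilityMeasure E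
  discipline : Fin L → Finset ℤ → ℤ
  discipline_mem : ∀ i s, s.Nonempty → discipline i s ∈ s

namespace SensorNetwork

instance : MeasurableSpace (Finset ℤ) := ⊤

/-- For every nonempty set of sensors, a choice of one of its members. -/
abbrev Pick (L : ℕ) : Type := (S : {S : Finset (Fin L) // S.Nonempty}) → S.1

/-- The randomness of one slot: which sensors take a sample, whether the channel would deliver a
packet, and which sensor would be granted the channel out of each set of contending sensors. -/
abbrev SlotNoise (L : ℕ) : Type := (Fin L → Bool) × Bool × Pick L

/-- What the decision maker observes in one slot: no transmission, a failed transmission, or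
the sensor `U`, the sampling slot `J` and the measurement `Z` of a received packet. -/
abbrev SlotObs (L : ℕ) (E : Type*) : Type _ := Unit ⊕ Unit ⊕ (Fin L × ℤ × E)

/-- Sample space: the queue contents at the beginning of slot `1`, the randomness of the slots
(entry `k` belongs to slot `k + 1`), and the measurement `X t i` of each sensor `i` in each
slot `t`. -/
abbrev Outcome (L : ℕ) (E : Type*) : Type _ :=
  (Fin L → Finset ℤ) × (ℕ → SlotNoise L) × (ℤ × Fin L → E)

/-- The sensor that transmits, given the queue lengths: one of those with a nonempty queue. -/
def transmitter {L : ℕ} (w : SlotNoise L) (q : Fin L → ℕ) : Option (Fin L) :=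
  if h : (Finset.univ.filter fun i => q i ≠ 0).Nonempty then some (w.2.2 ⟨_, h⟩).1 else none

/-- The sensor whose packet is received: `some i` encodes `Y = 1, U = i`. -/
def delivered {L : ℕ} (w : SlotNoise L) (q : Fin L → ℕ) : Option (Fin L) :=
  if w.2.1 then transmitter w q else none

/-- Evolution of the queue lengths over one slot. -/
def lengthStep {L : ℕ} (w : SlotNoise L) (q : Fin L → ℕ) : Fin L → ℕ := fun i =>
  (q i - if delivered w q = some i then 1 else 0) + if w.1 i then 1 else 0

/-- Sampling, channel and scheduling are independent; the transmitting sensor is uniform on the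
set of sensors with a nonempty queue. -/
noncomputable def slotLaw {L : ℕ} {E : Type*} [MeasurableSpace E] (N : SensorNetwork L E) :
    Measure (SlotNoise L) :=
  (Measure.pi fun i => bernoulliMeasure true false (N.rate i)).prod
    ((bernoulliMeasure true false N.success).prod
      (Measure.pi fun S : {S : Finset (Fin L) // S.Nonempty} =>
        uniformOn (Set.univ : Set S.1)))

instance {L : ℕ} {E : Type*} [MeasurableSpace E] (N : SensorNetwork L E) :
    IsProbabilityMeasure N.slotLaw := by
  have h : ∀ S : {S : Finset (Fin L) // S.Nonempty},
      IsProbabilityMeasure (uniformOn (Set.univ : Set S.1)) := fun S =>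
    isProbabilityMeasure_uniformOn Set.finite_univ
      (@Set.univ_nonempty _ S.2.to_subtype)
  unfold slotLaw
  infer_instance

section Dynamics

variable {L : ℕ} {E : Type*} [MeasurableSpace E] (N : SensorNetwork L E)

/-- Evolution of the queue contents over slot `t`: the received packet leaves, and the samples
taken in slot `t` enter, to be available from slot `t + 1` on. -/
def queueStep (w : SlotNoise L) (t : ℤ) (s : Fin L → Finset ℤ) : Fin L → Finset ℤ := fun i =>
  (if delivered w (fun j => (s j).card) = some i then (s i).erase (N.discipline i (s i)) else s i)
    ∪ (if w.1 i then {t} else ∅)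

/-- The queue contents at the beginning of slot `k + 1`. -/
def queueAt (ω : Outcome L E) : ℕ → Fin L → Finset ℤ
  | 0 => ω.1
  | k + 1 => N.queueStep (ω.2.1 k) ((k : ℤ) + 1) (queueAt ω k)

/-- The observation `(U, Y, J, Z)` in a slot with randomness `w` and initial queue contents `s`,
when the measurements are `X`. -/
def slotObs (w : SlotNoise L) (s : Fin L → Finset ℤ) (X : ℤ × Fin L → E) : SlotObs L E :=
  match transmitter w (fun j => (s j).card) with
  | none => Sum.inl ()
  | some i =>
    if w.2.1 then Sum.inr (Sum.inr (i, N.discipline i (s i), X (N.discipline i (s i), i)))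
    else Sum.inr (Sum.inl ())

/-- The observation of the decision maker in slot `k + 1`. -/
def obsAt (ω : Outcome L E) (k : ℕ) : SlotObs L E :=
  N.slotObs (ω.2.1 k) (N.queueAt ω k) ω.2.2

/-- The observations in the slots `1, …, n`. -/
def obs (n : ℕ) (ω : Outcome L E) : Fin n → SlotObs L E := fun k => N.obsAt ω k

/-- Law of the measurement of sensor `x.2` in slot `x.1` when the change happens at the end of
slot `ν`. -/
noncomputable def sampleLaw (ν : WithTop ℤ) (x : ℤ × Fin L) : Measure E :=
  if (x.1 : WithTop ℤ) ≤ ν then (N.pre x.2 : Measure E) else (N.post x.2 : Measure E)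

instance (ν : WithTop ℤ) (x : ℤ × Fin L) : IsProbabilityMeasure (N.sampleLaw ν x) := by
  unfold sampleLaw
  split_ifs <;> infer_instance

/-- The law `P_ν` on the sample space, when the initial queue contents have law `init`. -/
noncomputable def law (init : PMF (Fin L → Finset ℤ)) (ν : WithTop ℤ) : Measure (Outcome L E) :=
  init.toMeasure.prod
    ((Measure.infinitePi fun _ : ℕ => N.slotLaw).prod (Measure.infinitePi (N.sampleLaw ν)))

/-- The law under `P_ν` of the observations in the slots `1, …, n`. -/
noncomputable def obsLaw (init : PMF (Fin L → Finset ℤ)) (ν : WithTop ℤ) (n : ℕ) :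
    Measure (Fin n → SlotObs L E) :=
  (N.law init ν).map (N.obs n)

/-- The log-likelihood ratio of `P_ν` against `P_∞` for the observations in the slots
`1, …, n`. -/
noncomputable def logLR (init : PMF (Fin L → Finset ℤ)) (ν : WithTop ℤ) (n : ℕ)
    (ω : Outcome L E) : ℝ :=
  llr (N.obsLaw init ν n) (N.obsLaw init ⊤ n) (N.obs n ω)

/-- Stationary distributions of the Markov chain of queue-length vectors. -/
def IsStationary (π : Measure (Fin L → ℕ)) : Prop :=
  IsProbabilityMeasure π ∧
    (π.prod N.slotLaw).map (fun x => lengthStep x.2 x.1) = π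

/-- The event `Y = 1`, on pairs of queue lengths at the beginning of a slot and randomness of
that slot. -/
def received (L : ℕ) : Set ((Fin L → ℕ) × SlotNoise L) := {x | (delivered x.2 x.1).isSome}

/-- The event `Y = 1, U = i`. -/
def receivedFrom {L : ℕ} (i : Fin L) : Set ((Fin L → ℕ) × SlotNoise L) :=
  {x | delivered x.2 x.1 = some i}

end Dynamics

end SensorNetwork

/-! Stationarity. A nonempty system always transmits, so away from the empty state the total queue
length has drift `∑ r_i - p < 0`. Hence the mean time between visits to the empty state is finite,
and the expected occupation of such a cycle is a finite invariant measure (`push_occupation`). Any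
finite invariant measure dominates a multiple of it; the remainder is invariant, does not charge the
empty state, and so vanishes (`eq_smul_occupation`). Flow balance in a single queue equates its
departure rate with its sampling rate (`measureReal_receivedFrom`).

Likelihood. Freeze the initial contents and the slot noise, whose joint law does not depend on the
change point. They determine which packet is received in which slot, and no packet is received
twice. The measurements stay independent, so the likelihood ratio is the product of the
single-sample ratios over the received packets, and timing carries no information
(`obsLaw_zero_eq_withDensity`).

Rate. For almost every noise path the queues grow sublinearly (`tendsto_queue_div_zero`), so
post-change packets of sensor `i` arrive with frequency `r_i` under any discipline
(`tendsto_count_freshFrom_div`). Packets from slots `≤ 0` contribute ratio one. Since the order of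
reception does not depend on the measurements, the strong law applies along it and yields each
divergence, finite or not (`strong_law_llr`). No ergodic theorem for the chain is needed. -/

namespace SensorNetwork

/-! ### The queue-length chain: invariant measures and flow balance. -/

section Chain

variable {L : ℕ} {E : Type*} [MeasurableSpace E] (N : SensorNetwork L E)

lemma ne_zero_of_transmitter_eq_some {w : SlotNoise L} {q : Fin L → ℕ} {i : Fin L}
    (h : transmitter w q = some i) : q i ≠ 0 := by
  unfold transmitter at h
  split_ifs at h with hne
  have := (w.2.2 ⟨_, hne⟩).2
  rw [Option.some.injEq] at h
  rw [← h]
  exact (Finset.mem_filter.1 this).2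

lemma exists_transmitter_eq_some (w : SlotNoise L) {q : Fin L → ℕ} (hq : q ≠ 0) :
    ∃ i, transmitter w q = some i := by
  obtain ⟨i, hi⟩ := Function.ne_iff.1 hq
  have hne : (Finset.univ.filter fun i => q i ≠ 0).Nonempty := ⟨i, by simpa using hi⟩
  exact ⟨_, dif_pos hne⟩

lemma delivered_eq_some_iff {w : SlotNoise L} {q : Fin L → ℕ} {i : Fin L} :
    delivered w q = some i ↔ w.2.1 = true ∧ transmitter w q = some i := by
  unfold delivered
  split_ifs with h <;> simp [h]

/-- The truncated subtraction in `lengthStep` never truncates, because a delivering sensor has a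
nonempty queue. The additive form lets the balance be summed and cast. -/
lemma lengthStep_add (w : SlotNoise L) (q : Fin L → ℕ) (i : Fin L) :
    lengthStep w q i + (if delivered w q = some i then 1 else 0) =
      q i + if w.1 i then 1 else 0 := by
  unfold lengthStep
  by_cases h : delivered w q = some i
  · have := ne_zero_of_transmitter_eq_some (delivered_eq_some_iff.1 h).2
    simp only [h, if_true]
    omega
  · simp [h]

/-- Work conservation: in a nonempty system some sensor transmits, so departures are governed by the
channel alone, whatever the scheduling. -/
lemma sum_lengthStep_add (w : SlotNoise L) {q : Fin L → ℕ} (hq : q ≠ 0) :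
    ∑ i, lengthStep w q i + (if w.2.1 then 1 else 0) =
      ∑ i, q i + ∑ i, if w.1 i then 1 else 0 := by
  have h : (if w.2.1 then 1 else 0) = ∑ i, if delivered w q = some i then 1 else 0 := by
    obtain ⟨j, hj⟩ := exists_transmitter_eq_some w hq
    simp only [delivered_eq_some_iff, hj, Option.some.injEq]
    by_cases hw : w.2.1 = true <;> simp [hw]
  rw [h, ← Finset.sum_add_distrib, ← Finset.sum_add_distrib]
  exact Finset.sum_congr rfl fun i _ => lengthStep_add w q i

lemma transmitter_zero (w : SlotNoise L) : transmitter w 0 = none := by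
  cases h : transmitter w 0 with
  | none => rfl
  | some i => exact absurd rfl (ne_zero_of_transmitter_eq_some h)

lemma lengthStep_zero (w : SlotNoise L) (i : Fin L) :
    lengthStep w 0 i = if w.1 i then 1 else 0 := by
  simp [lengthStep, delivered, transmitter_zero]

lemma coe_toNNReal_eq_ofReal (p : unitInterval) :
    ((unitInterval.toNNReal p : NNReal) : ℝ≥0∞) = ENNReal.ofReal p := by
  rw [ENNReal.ofReal, Real.toNNReal_of_nonneg p.2.1]
  rfl

lemma bernoulliMeasure_true (p : unitInterval) :
    bernoulliMeasure true false p {true} = ENNReal.ofReal p := by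
  rw [bernoulliMeasure_apply_of_mem_of_notMem p (MeasurableSet.of_discrete) (by simp) (by simp),
    coe_toNNReal_eq_ofReal]

lemma bernoulliMeasure_false (p : unitInterval) :
    bernoulliMeasure true false p {false} = ENNReal.ofReal (1 - p) := by
  have h : ({false} : Set Bool) = {true}ᶜ := by ext b; cases b <;> simp
  rw [h, prob_compl_eq_one_sub (MeasurableSet.of_discrete), bernoulliMeasure_true,
    ENNReal.ofReal_sub _ p.2.1, ENNReal.ofReal_one]

instance isProbabilityMeasure_pick :
    IsProbabilityMeasure (Measure.pi fun S : {S : Finset (Fin L) // S.Nonempty} =>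
        uniformOn (Set.univ : Set S.1)) := by
  have h : ∀ S : {S : Finset (Fin L) // S.Nonempty},
      IsProbabilityMeasure (uniformOn (Set.univ : Set S.1)) := fun S =>
    isProbabilityMeasure_uniformOn Set.finite_univ
      (@Set.univ_nonempty _ S.2.to_subtype)
  infer_instance

lemma map_sampled_slotLaw :
    N.slotLaw.map (fun w => w.1) = Measure.pi fun i => bernoulliMeasure true false (N.rate i) := by
  unfold slotLaw
  exact (measurePreserving_fst).map_eq

lemma map_success_slotLaw :
    N.slotLaw.map (fun w => w.2.1) = bernoulliMeasure true false N.success := by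
  unfold slotLaw
  exact (measurePreserving_fst.comp measurePreserving_snd).map_eq

lemma slotLaw_sampled (i : Fin L) :
    N.slotLaw {w | w.1 i = true} = ENNReal.ofReal (N.rate i) := by
  rw [← bernoulliMeasure_true, ← (measurePreserving_eval
    (fun i => bernoulliMeasure true false (N.rate i)) i).map_eq, ← map_sampled_slotLaw,
    Measure.map_map (by fun_prop) (by fun_prop),
    Measure.map_apply (by fun_prop) (MeasurableSet.of_discrete)]
  rfl

lemma slotLaw_success : N.slotLaw {w | w.2.1 = true} = ENNReal.ofReal N.success := by
  rw [← bernoulliMeasure_true, ← map_success_slotLaw,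
    Measure.map_apply (by fun_prop) (MeasurableSet.of_discrete)]
  rfl

/-- With positive probability nobody samples and the channel delivers. -/
lemma slotLaw_calm_ne_zero (hr : ∀ i, (N.rate i : ℝ) < 1) (hp : 0 < (N.success : ℝ)) :
    N.slotLaw {w | (∀ i, w.1 i = false) ∧ w.2.1 = true} ≠ 0 := by
  have h : {w : SlotNoise L | (∀ i, w.1 i = false) ∧ w.2.1 = true} =
      (Set.univ.pi fun _ => {false}) ×ˢ ({true} ×ˢ Set.univ) := by
    ext w; simp
  rw [h, slotLaw, Measure.prod_prod, Measure.prod_prod, Measure.pi_pi, measure_univ, mul_one,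
    bernoulliMeasure_true]
  refine mul_ne_zero (Finset.prod_ne_zero_iff.2 fun i _ => ?_) ?_
  · rw [bernoulliMeasure_false]
    simpa using hr i
  · simpa using hp

/-- The law of the queue lengths after one slot. -/
noncomputable def push (m : Measure (Fin L → ℕ)) : Measure (Fin L → ℕ) :=
  (m.prod N.slotLaw).map (fun x => lengthStep x.2 x.1)

lemma lintegral_push (m : Measure (Fin L → ℕ)) [SFinite m] (f : (Fin L → ℕ) → ℝ≥0∞) :
    ∫⁻ q, f q ∂N.push m = ∫⁻ q, ∫⁻ w, f (lengthStep w q) ∂N.slotLaw ∂m := by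
  rw [push, lintegral_map (.of_discrete) (.of_discrete),
    lintegral_prod _ (Measurable.of_discrete).aemeasurable]

lemma push_apply (m : Measure (Fin L → ℕ)) [SFinite m] (s : Set (Fin L → ℕ)) :
    N.push m s = ∫⁻ q, N.slotLaw {w | lengthStep w q ∈ s} ∂m := by
  rw [push, Measure.map_apply (.of_discrete) (.of_discrete),
    Measure.prod_apply (.of_discrete)]
  rfl

instance (m : Measure (Fin L → ℕ)) [IsFiniteMeasure m] : IsFiniteMeasure (N.push m) := by
  unfold push; infer_instance

lemma push_univ (m : Measure (Fin L → ℕ)) [SFinite m] : N.push m Set.univ = m Set.univ := by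
  simp [push_apply]

lemma push_add (m m' : Measure (Fin L → ℕ)) [SFinite m] [SFinite m'] :
    N.push (m + m') = N.push m + N.push m' := by
  ext s
  simp [push_apply, lintegral_add_measure]

lemma push_smul (c : ℝ≥0∞) (m : Measure (Fin L → ℕ)) [SFinite m] :
    N.push (c • m) = c • N.push m := by
  ext s
  simp [push_apply, lintegral_smul_measure]

lemma push_mono {m m' : Measure (Fin L → ℕ)} [SFinite m] [SFinite m'] (h : m ≤ m') :
    N.push m ≤ N.push m' := by
  refine Measure.le_iff.2 fun s _ => ?_
  rw [push_apply, push_apply]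
  exact lintegral_mono' h le_rfl

lemma push_sum (m : ℕ → Measure (Fin L → ℕ)) [∀ k, SFinite (m k)] :
    N.push (Measure.sum m) = Measure.sum fun k => N.push (m k) := by
  ext s hs
  simp [push_apply, Measure.sum_apply _ hs, lintegral_sum_measure]

lemma lintegral_sampled :
    ∫⁻ w, ((∑ i, if w.1 i then 1 else 0 : ℕ) : ℝ≥0∞) ∂N.slotLaw =
      ENNReal.ofReal (∑ i, (N.rate i : ℝ)) := by
  rw [ENNReal.ofReal_sum_of_nonneg fun i _ => (N.rate i).2.1]
  simp only [Nat.cast_sum, Nat.cast_ite, Nat.cast_one, Nat.cast_zero]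
  rw [lintegral_finsetSum _ fun i _ => .of_discrete]
  refine Finset.sum_congr rfl fun i _ => ?_
  rw [← slotLaw_sampled, ← lintegral_indicator_one (.of_discrete)]
  exact lintegral_congr fun w => by simp [Set.indicator]

lemma lintegral_success :
    ∫⁻ w, ((if w.2.1 then 1 else 0 : ℕ) : ℝ≥0∞) ∂N.slotLaw = ENNReal.ofReal N.success := by
  rw [← slotLaw_success, ← lintegral_indicator_one (.of_discrete)]
  exact lintegral_congr fun w => by simp [Set.indicator]

/-- The drift identity, arranged without subtraction so that it makes sense in `ℝ≥0∞`. -/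
lemma lintegral_sum_lengthStep {q : Fin L → ℕ} (hq : q ≠ 0) :
    ∫⁻ w, ((∑ i, lengthStep w q i : ℕ) : ℝ≥0∞) ∂N.slotLaw + ENNReal.ofReal N.success =
      ((∑ i, q i : ℕ) : ℝ≥0∞) + ENNReal.ofReal (∑ i, (N.rate i : ℝ)) := by
  rw [← lintegral_success, ← lintegral_sampled, ← lintegral_add_left (.of_discrete)]
  have h : ((∑ i, q i : ℕ) : ℝ≥0∞) = ∫⁻ _, ((∑ i, q i : ℕ) : ℝ≥0∞) ∂N.slotLaw := by simp
  rw [h, ← lintegral_add_left (.of_discrete)]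
  refine lintegral_congr fun w => ?_
  exact_mod_cast sum_lengthStep_add w hq

/-- The law of the queue lengths started empty, on the event that they have not been empty
again. -/
noncomputable def excursionAt : ℕ → Measure (Fin L → ℕ)
  | 0 => Measure.dirac 0
  | k + 1 => (N.push (excursionAt k)).restrict {0}ᶜ

instance isFiniteMeasure_excursionAt : ∀ k, IsFiniteMeasure (N.excursionAt k)
  | 0 => by unfold excursionAt; infer_instance
  | k + 1 => by
    have := isFiniteMeasure_excursionAt k
    unfold excursionAt
    infer_instance

/-- The expected occupation of the states between two visits to the empty state. -/
noncomputable def occupation : Measure (Fin L → ℕ) := Measure.sum N.excursionAt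

/-- Foster's drift inequality with the total length as Lyapunov function. The index starts at `k +
1` because only then is the excursion measure carried by nonempty states; killing at the empty state
can only lower the integral. -/
lemma lintegral_excursionAt_succ_add_le
    (hstable : ∑ i, (N.rate i : ℝ) < (N.success : ℝ)) (k : ℕ) :
    ∫⁻ q, ((∑ i, q i : ℕ) : ℝ≥0∞) ∂N.excursionAt (k + 2) +
        ENNReal.ofReal (N.success - ∑ i, (N.rate i : ℝ)) * N.excursionAt (k + 1) Set.univ ≤
      ∫⁻ q, ((∑ i, q i : ℕ) : ℝ≥0∞) ∂N.excursionAt (k + 1) := by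
  have hρ : 0 ≤ ∑ i, (N.rate i : ℝ) := Finset.sum_nonneg fun i _ => (N.rate i).2.1
  have h0 : ∀ᵐ q ∂N.excursionAt (k + 1), q ≠ 0 := by
    rw [excursionAt]
    filter_upwards [ae_restrict_mem (MeasurableSet.of_discrete)] with q hq using hq
  have h1 : ∫⁻ q, ((∑ i, q i : ℕ) : ℝ≥0∞) ∂N.excursionAt (k + 2) ≤
      ∫⁻ q, ∫⁻ w, ((∑ i, lengthStep w q i : ℕ) : ℝ≥0∞) ∂N.slotLaw ∂N.excursionAt (k + 1) := by
    rw [← lintegral_push N _ (fun q => ((∑ i, q i : ℕ) : ℝ≥0∞))]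
    exact lintegral_mono' Measure.restrict_le_self le_rfl
  refine (add_le_add_left h1 _).trans ?_
  rw [← lintegral_const, ← lintegral_add_right _ (.of_discrete)]
  refine lintegral_mono_ae ?_
  filter_upwards [h0] with q hq
  have h2 := N.lintegral_sum_lengthStep hq
  have h3 : ENNReal.ofReal N.success = ENNReal.ofReal (N.success - ∑ i, (N.rate i : ℝ)) +
      ENNReal.ofReal (∑ i, (N.rate i : ℝ)) := by
    rw [← ENNReal.ofReal_add (by linarith) hρ, sub_add_cancel]
  rw [h3, ← add_assoc] at h2
  exact ((ENNReal.add_left_inj ENNReal.ofReal_ne_top).1 h2).le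

lemma occupation_univ_lt_top (hstable : ∑ i, (N.rate i : ℝ) < (N.success : ℝ)) :
    N.occupation Set.univ < ∞ := by
  set ε := ENNReal.ofReal (N.success - ∑ i, (N.rate i : ℝ)) with hε
  have hε0 : ε ≠ 0 := by simpa [hε] using hstable
  set V := fun k => ∫⁻ q, ((∑ i, q i : ℕ) : ℝ≥0∞) ∂N.excursionAt k with hV
  -- Telescoping the drift inequality bounds the expected excursion length by the mean total length
  -- after one step from the empty state.
  have h1 : ∀ n, V (n + 1) + ∑ k ∈ Finset.range n, ε * N.excursionAt (k + 1) Set.univ ≤ V 1 := by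
    intro n
    induction n with
    | zero => simp
    | succ n ih =>
      refine le_trans ?_ ih
      rw [Finset.sum_range_succ, add_comm (Finset.sum _ _), ← add_assoc]
      exact add_le_add_left (N.lintegral_excursionAt_succ_add_le hstable n) _
  have hV1 : V 1 ≠ ∞ := by
    refine ((lintegral_mono' (Measure.restrict_le_self) le_rfl).trans_lt ?_).ne
    rw [lintegral_push, excursionAt, lintegral_dirac]
    simp_rw [lengthStep_zero]
    rw [lintegral_sampled]
    exact ENNReal.ofReal_lt_top
  have h2 : ∑' k, ε * N.excursionAt (k + 1) Set.univ ≤ V 1 := by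
    rw [ENNReal.tsum_eq_iSup_nat]
    exact iSup_le fun n => le_add_self.trans (h1 n)
  rw [ENNReal.tsum_mul_left] at h2
  have h3 : ∑' k, N.excursionAt (k + 1) Set.univ ≠ ∞ := by
    intro h
    rw [h, ENNReal.mul_top hε0] at h2
    exact hV1 (top_le_iff.1 h2)
  rw [occupation, Measure.sum_apply _ MeasurableSet.univ, tsum_eq_zero_add' ENNReal.summable]
  exact ENNReal.add_lt_top.2 ⟨measure_lt_top _ _, h3.lt_top⟩

lemma occupation_eq :
    N.occupation = Measure.dirac 0 + (N.push N.occupation).restrict {0}ᶜ := by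
  conv_rhs => rw [occupation, push_sum, Measure.restrict_sum _ (.of_discrete)]
  ext s hs
  rw [occupation, Measure.sum_apply _ hs, tsum_eq_zero_add' ENNReal.summable, Measure.add_apply,
    Measure.sum_apply _ hs]
  rfl

/-- By `occupation_eq`, invariance can fail only at the empty state. One step preserves the finite
total mass, which forces the mass returned there to be exactly the unit started there. -/
lemma push_occupation (hstable : ∑ i, (N.rate i : ℝ) < (N.success : ℝ)) :
    N.push N.occupation = N.occupation := by
  have hfin : IsFiniteMeasure N.occupation := ⟨N.occupation_univ_lt_top hstable⟩
  have h1 : N.push N.occupation {0} = 1 := by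
    have h2 := congrArg (fun m => m Set.univ) N.occupation_eq
    simp only [Measure.add_apply, measure_univ, Measure.restrict_apply_univ] at h2
    rw [← N.push_univ N.occupation, ← measure_add_measure_compl (s := {0}) (.of_discrete)] at h2
    exact (ENNReal.add_left_inj (measure_ne_top _ _)).1 h2
  have h3 := Measure.restrict_add_restrict_compl (μ := N.push N.occupation) (s := {0})
    (.of_discrete)
  rw [Measure.restrict_singleton, h1, one_smul, ← occupation_eq] at h3
  exact h3.symm

lemma occupation_singleton_zero : N.occupation {0} = 1 := by
  rw [occupation_eq, Measure.add_apply, Measure.restrict_apply (.of_discrete)]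
  simp

/-- An invariant measure that does not charge the empty state vanishes. -/
lemma eq_zero_of_push_eq (hr : ∀ i, (N.rate i : ℝ) < 1) (hp : 0 < (N.success : ℝ))
    {m : Measure (Fin L → ℕ)} [SFinite m] (hm : N.push m = m) (h0 : m {0} = 0) : m = 0 := by
  have key : ∀ n, m {q | ∑ i, q i ≤ n} = 0 := by
    intro n
    induction n with
    | zero =>
      convert h0 using 2
      ext q
      simp [funext_iff]
    | succ n ih =>
      have h1 := ih
      rw [← hm, push_apply, lintegral_eq_zero_iff (.of_discrete)] at h1
      -- A calm slot shortens a nonempty system by one packet, so states of total length `n + 1`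
      -- enter the null set of shorter states with positive probability; invariance makes them null
      -- too.
      refine measure_mono_null (t := {q | ¬ N.slotLaw {w | lengthStep w q ∈ {q | ∑ i, q i ≤ n}} = 0}
        ∪ {q | ∑ i, q i ≤ n}) ?_ (measure_union_null h1 ih)
      intro q hq
      by_cases hq0 : q = 0
      · exact Or.inr (by simp [hq0])
      refine Or.inl fun h => N.slotLaw_calm_ne_zero hr hp (measure_mono_null ?_ h)
      rintro w ⟨hw1, hw2⟩
      have h2 := sum_lengthStep_add w hq0
      simp only [hw1, hw2, if_true, Bool.false_eq_true, if_false, Finset.sum_const_zero] at h2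
      simp only [Set.mem_ofPred_eq] at hq ⊢
      omega
  refine Measure.measure_univ_eq_zero.1 ?_
  have h2 : (Set.univ : Set (Fin L → ℕ)) = ⋃ n, {q | ∑ i, q i ≤ n} := by
    ext q
    simpa using ⟨_, le_rfl⟩
  rw [h2]
  exact measure_iUnion_null key

/-- Splitting `π` into its part at the empty state and the rest, and feeding this decomposition into
`push` repeatedly, exhibits the excursions one step at a time; the partial sums stay below `π`. -/
lemma smul_occupation_le {π : Measure (Fin L → ℕ)} [IsFiniteMeasure π] (hπ : N.push π = π) :
    π {0} • N.occupation ≤ π := by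
  have hdec : π = π {0} • Measure.dirac 0 + (N.push π).restrict {0}ᶜ := by
    rw [hπ, ← Measure.restrict_singleton]
    exact (Measure.restrict_add_restrict_compl (.of_discrete)).symm
  set c := π {0} with hc
  have hfin : ∀ n, SFinite (∑ k ∈ Finset.range n, N.excursionAt k) := fun n => by
    rw [← Measure.sum_coe_finset]; infer_instance
  have key : ∀ n, c • ∑ k ∈ Finset.range n, N.excursionAt k ≤ π := by
    intro n
    induction n with
    | zero => simpa using Measure.zero_le π
    | succ n ih =>
      have h1 : c • ∑ k ∈ Finset.range (n + 1), N.excursionAt k = c • Measure.dirac 0 +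
          (N.push (c • ∑ k ∈ Finset.range n, N.excursionAt k)).restrict {0}ᶜ := by
        have h2 : ∀ n, (N.push (∑ k ∈ Finset.range n, N.excursionAt k)).restrict {0}ᶜ =
            ∑ k ∈ Finset.range n, N.excursionAt (k + 1) := by
          intro n
          induction n with
          | zero => ext s; simp [push_apply]
          | succ n ih =>
            rw [Finset.sum_range_succ, push_add, Measure.restrict_add, ih, Finset.sum_range_succ]
            rfl
        rw [Finset.sum_range_succ', push_smul, Measure.restrict_smul, h2, smul_add, add_comm]
        rfl
      rw [h1]
      conv_rhs => rw [hdec]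
      exact add_le_add_right (Measure.restrict_mono le_rfl (N.push_mono ih)) _
  refine Measure.le_iff.2 fun s hs => ?_
  rw [Measure.smul_apply, occupation, Measure.sum_apply _ hs, smul_eq_mul,
    ENNReal.tsum_eq_iSup_nat, ENNReal.mul_iSup]
  refine iSup_le fun n => ?_
  have := key n s
  simpa using this

lemma eq_smul_occupation (hr : ∀ i, (N.rate i : ℝ) < 1)
    (hstable : ∑ i, (N.rate i : ℝ) < (N.success : ℝ))
    {π : Measure (Fin L → ℕ)} [IsFiniteMeasure π] (hπ : N.push π = π) :
    π = π {0} • N.occupation := by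
  have hp : 0 < (N.success : ℝ) :=
    (Finset.sum_nonneg fun i _ => (N.rate i).2.1).trans_lt hstable
  have hfin : IsFiniteMeasure N.occupation := ⟨N.occupation_univ_lt_top hstable⟩
  have hfin' : IsFiniteMeasure (π {0} • N.occupation) := by
    refine ⟨?_⟩
    rw [Measure.smul_apply, smul_eq_mul]
    exact ENNReal.mul_lt_top (measure_lt_top _ _) (measure_lt_top _ _)
  have hsub := Measure.sub_add_cancel_of_le (N.smul_occupation_le hπ)
  have hinv : N.push (π {0} • N.occupation) = π {0} • N.occupation := by
    rw [push_smul, N.push_occupation hstable]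
  -- Both `π` and the subtracted multiple are finite and invariant, so the remainder is invariant by
  -- cancellation.
  have hρ : N.push (π - π {0} • N.occupation) = π - π {0} • N.occupation := by
    have h1 := hπ
    conv_lhs at h1 => rw [← hsub, push_add, hinv]
    ext s hs
    have h2 := congrArg (fun m => m s) (h1.trans hsub.symm)
    exact (ENNReal.add_left_inj (measure_ne_top (π {0} • N.occupation) s)).1 h2
  have h0 : (π - π {0} • N.occupation) {0} = 0 := by
    rw [Measure.sub_apply (.of_discrete) (N.smul_occupation_le hπ), Measure.smul_apply,
      occupation_singleton_zero]
    simp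
  rw [N.eq_zero_of_push_eq hr hp hρ h0, zero_add] at hsub
  exact hsub.symm

theorem existsUnique_isStationary (hstable : ∑ i, (N.rate i : ℝ) < (N.success : ℝ)) :
    ∃! π : Measure (Fin L → ℕ), N.IsStationary π := by
  have hr : ∀ i, (N.rate i : ℝ) < 1 := fun i =>
    (Finset.single_le_sum (f := fun i => (N.rate i : ℝ)) (fun j _ => (N.rate j).2.1)
      (Finset.mem_univ i)).trans_lt (hstable.trans_le N.success.2.2)
  have hlt := N.occupation_univ_lt_top hstable
  have hfin : IsFiniteMeasure N.occupation := ⟨hlt⟩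
  have hne : N.occupation Set.univ ≠ 0 := fun h => by
    have := measure_mono_null (Set.subset_univ {0}) h
    rw [occupation_singleton_zero] at this
    exact one_ne_zero this
  refine ⟨(N.occupation Set.univ)⁻¹ • N.occupation, ⟨⟨?_⟩, ?_⟩, fun π ⟨hprob, hπ⟩ => ?_⟩
  · rw [Measure.smul_apply, smul_eq_mul, ENNReal.inv_mul_cancel hne hlt.ne]
  · exact (N.push_smul _ _).trans (by rw [N.push_occupation hstable])
  · have h := N.eq_smul_occupation hr hstable hπ
    have h1 := congrArg (fun m => m Set.univ) h
    simp only [measure_univ, Measure.smul_apply, smul_eq_mul] at h1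
    rw [← ENNReal.eq_inv_of_mul_eq_one_left h1.symm]
    exact h

/-- In steady state the mean increment of a queue is zero, and the increment is the sampling
indicator minus the delivery indicator. The queue length is not known to be integrable, so it is
truncated at `M` first; truncated increments are bounded by one and dominated convergence removes
the truncation. -/
lemma measureReal_receivedFrom {π : Measure (Fin L → ℕ)} (hπ : N.IsStationary π) (i : Fin L) :
    (π.prod N.slotLaw).real (receivedFrom i) = N.rate i := by
  obtain ⟨hprob, hπ⟩ := hπ
  set m := π.prod N.slotLaw with hm
  set F : ℕ → (Fin L → ℕ) × SlotNoise L → ℝ := fun M x =>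
    ((min (lengthStep x.2 x.1 i) M : ℕ) : ℝ) - ((min (x.1 i) M : ℕ) : ℝ) with hF
  have hint : ∀ (M : ℕ) (f : (Fin L → ℕ) × SlotNoise L → ℕ),
      Integrable (fun x => ((min (f x) M : ℕ) : ℝ)) m := fun M f =>
    Integrable.of_bound (Measurable.of_discrete).aestronglyMeasurable M
      (ae_of_all _ fun x => by
        rw [Real.norm_of_nonneg (Nat.cast_nonneg _)]
        exact_mod_cast min_le_right _ _)
  have hzero : ∀ M, ∫ x, F M x ∂m = 0 := by
    intro M
    have h1 : ∫ x, ((min (lengthStep x.2 x.1 i) M : ℕ) : ℝ) ∂m =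
        ∫ q, ((min (q i) M : ℕ) : ℝ) ∂π := by
      conv_rhs => rw [← hπ]
      rw [integral_map (Measurable.of_discrete).aemeasurable
        (Measurable.of_discrete).aestronglyMeasurable]
    have h2 : ∫ x, ((min (x.1 i) M : ℕ) : ℝ) ∂m = ∫ q, ((min (q i) M : ℕ) : ℝ) ∂π := by
      have : π = m.map Prod.fst := (measurePreserving_fst.map_eq).symm
      conv_rhs => rw [this]
      rw [integral_map (Measurable.of_discrete).aemeasurable
        (Measurable.of_discrete).aestronglyMeasurable]
    rw [integral_sub (hint _ _) (hint _ _), h1, h2, sub_self]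
  have hlim : Tendsto (fun M => ∫ x, F M x ∂m) atTop
      (𝓝 (∫ x, ((lengthStep x.2 x.1 i : ℝ) - (x.1 i : ℝ)) ∂m)) := by
    refine tendsto_integral_of_dominated_convergence (fun _ => 1)
      (fun M => (Measurable.of_discrete).aestronglyMeasurable) (integrable_const _)
      (fun M => ae_of_all _ fun x => ?_) (ae_of_all _ fun x => ?_)
    · have h1 := lengthStep_add x.2 x.1 i
      rw [Real.norm_eq_abs, abs_le]
      have h2 : min (lengthStep x.2 x.1 i) M ≤ min (x.1 i) M + 1 := by
        split_ifs at h1 <;> omega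
      have h3 : min (x.1 i) M ≤ min (lengthStep x.2 x.1 i) M + 1 := by
        split_ifs at h1 <;> omega
      have h2' : ((min (lengthStep x.2 x.1 i) M : ℕ) : ℝ) ≤ ((min (x.1 i) M : ℕ) : ℝ) + 1 := by
        exact_mod_cast h2
      have h3' : ((min (x.1 i) M : ℕ) : ℝ) ≤ ((min (lengthStep x.2 x.1 i) M : ℕ) : ℝ) + 1 := by
        exact_mod_cast h3
      simp only [hF]
      constructor <;> linarith
    · refine tendsto_const_nhds.congr' ?_
      filter_upwards [eventually_ge_atTop (lengthStep x.2 x.1 i), eventually_ge_atTop (x.1 i)]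
        with M h1 h2
      simp only [hF, min_eq_left h1, min_eq_left h2]
  simp only [hzero] at hlim
  have h0 := tendsto_nhds_unique hlim tendsto_const_nhds
  have h1 : ∀ x : (Fin L → ℕ) × SlotNoise L, ((lengthStep x.2 x.1 i : ℝ) - (x.1 i : ℝ)) =
      Set.indicator {x | x.2.1 i = true} 1 x - Set.indicator (receivedFrom i) 1 x := by
    intro x
    have h2 := lengthStep_add x.2 x.1 i
    simp only [Set.indicator, receivedFrom, Set.mem_ofPred_eq, Pi.one_apply]
    have h3 : (lengthStep x.2 x.1 i : ℝ) + (if delivered x.2 x.1 = some i then 1 else 0) =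
      (x.1 i : ℝ) + if x.2.1 i = true then 1 else 0 := by exact_mod_cast h2
    by_cases ha : x.2.1 i = true <;> by_cases hb : delivered x.2 x.1 = some i <;>
      simp only [ha, hb, if_true, if_false, Bool.false_eq_true] at h3 ⊢ <;> linarith
  simp_rw [h1] at h0
  have hi : ∀ s : Set ((Fin L → ℕ) × SlotNoise L), Integrable (s.indicator (1 : (Fin L → ℕ) × SlotNoise L → ℝ)) m :=
    fun s => (integrable_const (1 : ℝ)).indicator (.of_discrete)
  rw [integral_sub (hi _) (hi _), integral_indicator_one (.of_discrete),
    integral_indicator_one (.of_discrete)] at h0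
  have h4 : m.real {x | x.2.1 i = true} = N.rate i := by
    have : {x : (Fin L → ℕ) × SlotNoise L | x.2.1 i = true} =
      Set.univ ×ˢ {w | w.1 i = true} := by ext; simp
    rw [this, measureReal_def, hm, Measure.prod_prod, measure_univ, one_mul, slotLaw_sampled,
      ENNReal.toReal_ofReal (N.rate i).2.1]
  linarith

lemma received_eq_iUnion : received L = ⋃ i, receivedFrom i := by
  ext x
  simp [received, receivedFrom, Option.isSome_iff_exists]

lemma measureReal_received {π : Measure (Fin L → ℕ)} (hπ : N.IsStationary π) :
    (π.prod N.slotLaw).real (received L) = ∑ i, (N.rate i : ℝ) := by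
  have := hπ.1
  rw [received_eq_iUnion, measureReal_iUnion_fintype]
  · exact Finset.sum_congr rfl fun i _ => N.measureReal_receivedFrom hπ i
  · intro i j hij
    refine Set.disjoint_left.2 fun x hi hj => hij ?_
    simp only [receivedFrom, Set.mem_ofPred_eq] at hi hj
    exact Option.some.inj (hi.symm.trans hj)
  · exact fun i => .of_discrete

lemma cond_received_receivedFrom {π : Measure (Fin L → ℕ)} (hπ : N.IsStationary π) (i : Fin L) :
    ((π.prod N.slotLaw)[|received L]).real (receivedFrom i) =
      (N.rate i : ℝ) / ∑ j, (N.rate j : ℝ) := by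
  have := hπ.1
  have h : received L ∩ receivedFrom i = receivedFrom i := by
    rw [received_eq_iUnion]
    exact Set.inter_eq_right.2 (Set.subset_iUnion _ i)
  rw [measureReal_def, cond_apply (.of_discrete), ENNReal.toReal_mul, ENNReal.toReal_inv, h,
    ← measureReal_def, ← measureReal_def, N.measureReal_receivedFrom hπ,
    N.measureReal_received hπ, inv_mul_eq_div]

end Chain

end SensorNetwork

/-! ### Densities of product measures. -/

section Density

variable {ι : Type*} {X : ι → Type*} [∀ i, MeasurableSpace (X i)]

/-- It suffices to compare on boxes, where the integral of the product factorizes by independence of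
the coordinates. -/
lemma pi_eq_withDensity_prod [Fintype ι] (μ ν : ∀ i, Measure (X i))
    [∀ i, IsProbabilityMeasure (μ i)] [∀ i, IsProbabilityMeasure (ν i)]
    {ρ : ∀ i, X i → ℝ≥0∞} (hρ : ∀ i, Measurable (ρ i))
    (h : ∀ i, μ i = (ν i).withDensity (ρ i)) :
    Measure.pi μ = (Measure.pi ν).withDensity fun y => ∏ i, ρ i (y i) := by
  refine Measure.pi_eq fun s hs => ?_
  have h1 : ∀ y : ∀ i, X i, (Set.univ.pi s).indicator (fun y => ∏ i, ρ i (y i)) y =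
      ∏ i, (s i).indicator (ρ i) (y i) := by
    intro y
    by_cases hy : y ∈ Set.univ.pi s
    · rw [Set.indicator_of_mem hy]
      exact Finset.prod_congr rfl fun i _ => (Set.indicator_of_mem (hy i trivial) _).symm
    · rw [Set.indicator_of_notMem hy]
      obtain ⟨i, hi⟩ : ∃ i, y i ∉ s i := by simpa using hy
      exact (Finset.prod_eq_zero (Finset.mem_univ i) (Set.indicator_of_notMem hi _)).symm
  rw [withDensity_apply _ (MeasurableSet.univ_pi hs),
    ← lintegral_indicator (MeasurableSet.univ_pi hs), lintegral_congr h1]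
  refine (lintegral_prod_eq_prod_lintegral_of_indepFun Finset.univ
    (fun i (y : ∀ i, X i) => (s i).indicator (ρ i) (y i))
    (iIndepFun_pi fun i => ((hρ i).indicator (hs i)).aemeasurable)
    (fun i => ((hρ i).indicator (hs i)).comp (measurable_pi_apply i))).trans ?_
  refine Finset.prod_congr rfl fun i _ => ?_
  rw [(measurePreserving_eval ν i).lintegral_comp ((hρ i).indicator (hs i)),
    lintegral_indicator (hs i), ← withDensity_apply _ (hs i), h]

/-- Change of measure in finitely many coordinates of an infinite product. -/
lemma lintegral_infinitePi_eq_lintegral_mul_prod (μ ν : ∀ i, Measure (X i))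
    [∀ i, IsProbabilityMeasure (μ i)] [∀ i, IsProbabilityMeasure (ν i)]
    {ρ : ∀ i, X i → ℝ≥0∞} (hρ : ∀ i, Measurable (ρ i)) (D : Finset ι)
    (h : ∀ i ∈ D, μ i = (ν i).withDensity (ρ i)) {f : (∀ i, X i) → ℝ≥0∞} (hf : Measurable f)
    (hfD : DependsOn f D) :
    ∫⁻ y, f y ∂Measure.infinitePi μ =
      ∫⁻ y, f y * ∏ i ∈ D, ρ i (y i) ∂Measure.infinitePi ν := by
  classical
  -- An arbitrary base point fills in the coordinates outside `D`, so that `f` factors through the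
  -- restriction to `D`.
  have x : ∀ i, X i := fun i => (nonempty_of_isProbabilityMeasure (μ i)).some
  set g : (∀ i : D, X i) → ℝ≥0∞ := fun y => f (Function.updateFinset x D y) with hg
  have hgm : Measurable g := hf.comp measurable_updateFinset
  have hfg : ∀ y, f y = g (D.restrict y) := fun y =>
    hfD fun i hi => by simp [Function.updateFinset, Finset.mem_coe.1 hi]
  have hprod : ∀ y : ∀ i, X i, ∏ i ∈ D, ρ i (y i) = ∏ i : D, ρ i (D.restrict y i) := fun y =>
    (Finset.prod_coe_sort D fun i => ρ i (y i)).symm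
  simp_rw [hfg, hprod]
  have hm : Measurable fun y : ∀ i : D, X i => ∏ i : D, ρ i (y i) :=
    Finset.measurable_prod _ fun i _ => (hρ i).comp (measurable_pi_apply i)
  rw [lintegral_restrict_infinitePi μ hgm,
    lintegral_restrict_infinitePi ν (f := fun y => g y * ∏ i : D, ρ i (y i)) (hgm.mul hm),
    pi_eq_withDensity_prod (fun i : D => μ i) (fun i : D => ν i) (fun i => hρ i)
      (fun i => h i i.2), lintegral_withDensity_eq_lintegral_mul _ hm hgm]
  exact lintegral_congr fun y => mul_comm _ _

end Density

namespace SensorNetwork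

instance : DiscreteMeasurableSpace (Finset ℤ) := ⟨fun _ => trivial⟩

/-! ### Received packets and the likelihood ratio of the observations. -/

section Likelihood

variable {L : ℕ} {E : Type*} [MeasurableSpace E] (N : SensorNetwork L E)

/-- The queue contents as a function of the initial contents and of the slot randomness. -/
def queuePath (s : Fin L → Finset ℤ) (w : ℕ → SlotNoise L) : ℕ → Fin L → Finset ℤ
  | 0 => s
  | k + 1 => N.queueStep (w k) ((k : ℤ) + 1) (queuePath s w k)

lemma queueAt_eq (ω : Outcome L E) (k : ℕ) : N.queueAt ω k = N.queuePath ω.1 ω.2.1 k := by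
  induction k with
  | zero => rfl
  | succ k ih => rw [queueAt, queuePath, ih]

/-- The sampling slot and the sensor of the packet received in slot `k + 1`, if any. -/
def packet (s : Fin L → Finset ℤ) (w : ℕ → SlotNoise L) (k : ℕ) : Option (ℤ × Fin L) :=
  (delivered (w k) fun j => (N.queuePath s w k j).card).map fun i =>
    (N.discipline i (N.queuePath s w k i), i)

lemma packet_eq_some_iff {s : Fin L → Finset ℤ} {w : ℕ → SlotNoise L} {k : ℕ} {x : ℤ × Fin L} :
    N.packet s w k = some x ↔
      delivered (w k) (fun j => (N.queuePath s w k j).card) = some x.2 ∧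
        N.discipline x.2 (N.queuePath s w k x.2) = x.1 := by
  obtain ⟨t, i⟩ := x
  simp only [packet, Option.map_eq_some_iff, Prod.mk.injEq]
  constructor
  · rintro ⟨j, h1, h2, rfl⟩
    exact ⟨h1, h2⟩
  · rintro ⟨h1, h2⟩
    exact ⟨i, h1, h2, rfl⟩

lemma mem_queuePath_of_packet {s : Fin L → Finset ℤ} {w : ℕ → SlotNoise L} {k : ℕ}
    {x : ℤ × Fin L} (h : N.packet s w k = some x) : x.1 ∈ N.queuePath s w k x.2 := by
  obtain ⟨h1, h2⟩ := N.packet_eq_some_iff.1 h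
  have h3 := ne_zero_of_transmitter_eq_some (delivered_eq_some_iff.1 h1).2
  rw [← h2]
  exact N.discipline_mem _ _ (Finset.card_ne_zero.1 h3)

lemma mem_queuePath_succ {s : Fin L → Finset ℤ} {w : ℕ → SlotNoise L} {k : ℕ} {x : ℤ × Fin L} :
    x.1 ∈ N.queuePath s w (k + 1) x.2 ↔
      (x.1 ∈ N.queuePath s w k x.2 ∧ N.packet s w k ≠ some x) ∨
        ((w k).1 x.2 = true ∧ x.1 = (k : ℤ) + 1) := by
  rw [ne_eq, packet_eq_some_iff, queuePath, queueStep]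
  by_cases h1 : delivered (w k) (fun j => (N.queuePath s w k j).card) = some x.2 <;>
    by_cases h2 : (w k).1 x.2 = true <;> simp [h1, h2, and_comm, eq_comm] <;> tauto

lemma le_of_mem_queuePath {s : Fin L → Finset ℤ} (hs : ∀ i, ∀ t ∈ s i, t ≤ 0)
    (w : ℕ → SlotNoise L) (k : ℕ) (x : ℤ × Fin L) (h : x.1 ∈ N.queuePath s w k x.2) :
    x.1 ≤ k := by
  induction k with
  | zero => exact hs _ _ h
  | succ k ih =>
    rcases N.mem_queuePath_succ.1 h with h | h
    · have := ih h.1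
      push_cast
      omega
    · push_cast
      omega

/-- A waiting sample is stamped with an earlier slot than the current one, while every later entry
carries the stamp of its own slot; so a packet that has left never reappears. -/
lemma packet_ne_of_lt {s : Fin L → Finset ℤ} (hs : ∀ i, ∀ t ∈ s i, t ≤ 0)
    {w : ℕ → SlotNoise L} {k m : ℕ} (hkm : k < m) {x : ℤ × Fin L}
    (h : N.packet s w k = some x) : N.packet s w m ≠ some x := by
  have hle := N.le_of_mem_queuePath hs w k x (N.mem_queuePath_of_packet h)
  have key : x.1 ∉ N.queuePath s w m x.2 := by
    induction m, Nat.succ_le_of_lt hkm using Nat.le_induction with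
    | base =>
      rw [mem_queuePath_succ]
      rintro (h' | h')
      · exact h'.2 h
      · omega
    | succ m hm ih =>
      rw [mem_queuePath_succ]
      rintro (h' | h')
      · exact ih (by omega) h'.1
      · omega
  exact fun h' => key (N.mem_queuePath_of_packet h')

lemma packet_injective {s : Fin L → Finset ℤ} (hs : ∀ i, ∀ t ∈ s i, t ≤ 0)
    {w : ℕ → SlotNoise L} {k m : ℕ} {x : ℤ × Fin L}
    (h : N.packet s w k = some x) (h' : N.packet s w m = some x) : k = m := by
  rcases lt_trichotomy k m with hlt | heq | hlt
  · exact absurd h' (N.packet_ne_of_lt hs hlt h)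
  · exact heq
  · exact absurd h (N.packet_ne_of_lt hs hlt h')

lemma obsAt_of_packet_eq_some {s : Fin L → Finset ℤ} {w : ℕ → SlotNoise L} {k : ℕ}
    {x : ℤ × Fin L} (h : N.packet s w k = some x) (X : ℤ × Fin L → E) :
    N.obsAt (s, w, X) k = Sum.inr (Sum.inr (x.2, x.1, X x)) := by
  obtain ⟨h1, h2⟩ := N.packet_eq_some_iff.1 h
  obtain ⟨h3, h4⟩ := delivered_eq_some_iff.1 h1
  simp only [obsAt, slotObs, queueAt_eq, h3, h4, if_true, h2]

lemma obsAt_of_packet_eq_none {s : Fin L → Finset ℤ} {w : ℕ → SlotNoise L} {k : ℕ}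
    (h : N.packet s w k = none) (X : ℤ × Fin L → E) :
    N.obsAt (s, w, X) k =
      if (transmitter (w k) fun j => (N.queuePath s w k j).card).isSome then
        Sum.inr (Sum.inl ()) else Sum.inl () := by
  simp only [packet, Option.map_eq_none_iff, delivered] at h
  simp only [obsAt, slotObs, queueAt_eq]
  cases ht : transmitter (w k) fun j => (N.queuePath s w k j).card with
  | none => simp
  | some i =>
    rw [ht] at h
    simp at h
    simp [h]

/-- The likelihood ratio of one measurement. -/
noncomputable def sampleLR (x : ℤ × Fin L) (z : E) : ℝ≥0∞ :=
  if x.1 ≤ 0 then 1 else (N.post x.2 : Measure E).rnDeriv (N.pre x.2) z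

lemma measurable_sampleLR (x : ℤ × Fin L) : Measurable (N.sampleLR x) := by
  unfold sampleLR
  split_ifs
  · exact measurable_const
  · exact Measure.measurable_rnDeriv _ _

lemma sampleLaw_zero (x : ℤ × Fin L) :
    N.sampleLaw 0 x = if x.1 ≤ 0 then (N.pre x.2 : Measure E) else N.post x.2 := by
  unfold sampleLaw
  simp only [WithTop.coe_le_zero]

lemma sampleLaw_top (x : ℤ × Fin L) : N.sampleLaw ⊤ x = N.pre x.2 := by
  unfold sampleLaw
  simp

lemma sampleLaw_zero_eq_withDensity
    (hac : ∀ i, (N.post i : Measure E) ≪ (N.pre i : Measure E)) (x : ℤ × Fin L) :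
    N.sampleLaw 0 x = (N.sampleLaw ⊤ x).withDensity (N.sampleLR x) := by
  rw [sampleLaw_zero, sampleLaw_top]
  unfold sampleLR
  split_ifs with h
  · exact withDensity_one.symm
  · exact (Measure.withDensity_rnDeriv_eq _ _ (hac x.2)).symm

/-- The likelihood ratio contributed by one observation. -/
noncomputable def slotLR : SlotObs L E → ℝ≥0∞
  | Sum.inr (Sum.inr (i, t, z)) => N.sampleLR (t, i) z
  | _ => 1

lemma measurable_slotLR : Measurable N.slotLR := by
  refine measurable_fun_sum measurable_const (measurable_fun_sum measurable_const ?_)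
  refine measurable_from_prod_countable_right fun i => measurable_from_prod_countable_right
    fun t => N.measurable_sampleLR (t, i)

lemma slotLR_obsAt (s : Fin L → Finset ℤ) (w : ℕ → SlotNoise L) (X : ℤ × Fin L → E) (k : ℕ) :
    N.slotLR (N.obsAt (s, w, X) k) =
      ∏ x ∈ (N.packet s w k).toFinset, N.sampleLR x (X x) := by
  cases h : N.packet s w k with
  | none =>
    rw [N.obsAt_of_packet_eq_none h]
    split_ifs <;> simp [slotLR]
  | some x =>
    rw [N.obsAt_of_packet_eq_some h]
    simp [slotLR]

lemma measurable_queueAt (k : ℕ) : Measurable fun ω : Outcome L E => N.queueAt ω k := by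
  induction k with
  | zero => exact measurable_fst
  | succ k ih =>
    have h : Measurable fun p : SlotNoise L × (Fin L → Finset ℤ) =>
      N.queueStep p.1 ((k : ℤ) + 1) p.2 := .of_discrete
    exact h.comp (Measurable.prodMk (by fun_prop) ih)

lemma measurable_slotObs (w : SlotNoise L) (s : Fin L → Finset ℤ) :
    Measurable fun X : ℤ × Fin L → E => N.slotObs w s X := by
  unfold slotObs
  generalize transmitter w (fun j => (s j).card) = o
  cases o with
  | none => exact measurable_const
  | some i =>
    dsimp only
    split_ifs
    · exact measurable_inr.comp (measurable_inr.comp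
        (measurable_const.prodMk (measurable_const.prodMk (measurable_pi_apply _))))
    · exact measurable_const

lemma measurable_slotObs_uncurry :
    Measurable fun p : (SlotNoise L × (Fin L → Finset ℤ)) × (ℤ × Fin L → E) =>
      N.slotObs p.1.1 p.1.2 p.2 :=
  measurable_from_prod_countable_right fun p => N.measurable_slotObs p.1 p.2

lemma measurable_noise (k : ℕ) : Measurable fun ω : Outcome L E => ω.2.1 k :=
  (measurable_pi_apply k).comp (measurable_fst.comp measurable_snd)

lemma measurable_obsAt (k : ℕ) : Measurable fun ω : Outcome L E => N.obsAt ω k := by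
  have h : Measurable fun ω : Outcome L E => ((ω.2.1 k, N.queueAt ω k), ω.2.2) :=
    ((measurable_noise k).prodMk (N.measurable_queueAt k)).prodMk
      (measurable_snd.comp measurable_snd)
  have heq : (fun ω : Outcome L E => N.obsAt ω k) =
      (fun p : (SlotNoise L × (Fin L → Finset ℤ)) × (ℤ × Fin L → E) =>
        N.slotObs p.1.1 p.1.2 p.2) ∘ fun ω : Outcome L E => ((ω.2.1 k, N.queueAt ω k), ω.2.2) := by
    funext ω
    rw [obsAt, Function.comp_apply]
  rw [heq]
  exact N.measurable_slotObs_uncurry.comp h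

lemma measurable_obs (n : ℕ) : Measurable (N.obs n) :=
  measurable_pi_lambda _ fun k => N.measurable_obsAt k

instance (init : PMF (Fin L → Finset ℤ)) (ν : WithTop ℤ) :
    IsProbabilityMeasure (N.law init ν) := by
  unfold law; infer_instance

instance (init : PMF (Fin L → Finset ℤ)) (ν : WithTop ℤ) (n : ℕ) :
    IsProbabilityMeasure (N.obsLaw init ν n) :=
  Measure.isProbabilityMeasure_map (N.measurable_obs n).aemeasurable

lemma lintegral_law (init : PMF (Fin L → Finset ℤ)) (ν : WithTop ℤ) {f : Outcome L E → ℝ≥0∞}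
    (hf : Measurable f) :
    ∫⁻ ω, f ω ∂N.law init ν = ∫⁻ s, ∫⁻ w, ∫⁻ X, f (s, w, X)
      ∂Measure.infinitePi (N.sampleLaw ν) ∂Measure.infinitePi (fun _ : ℕ => N.slotLaw)
      ∂init.toMeasure := by
  rw [law, lintegral_prod _ hf.aemeasurable]
  refine lintegral_congr fun s => ?_
  exact lintegral_prod (fun p => f (s, p)) (hf.comp measurable_prodMk_left).aemeasurable

lemma ae_mem_support (init : PMF (Fin L → Finset ℤ)) : ∀ᵐ s ∂init.toMeasure, s ∈ init.support := by
  rw [← PMF.restrict_toMeasure_support]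
  exact ae_restrict_mem (.of_discrete)

/-- The packets received in the slots `1, …, n`. -/
def packets (s : Fin L → Finset ℤ) (w : ℕ → SlotNoise L) (n : ℕ) : Finset (ℤ × Fin L) :=
  (Finset.range n).biUnion fun k => (N.packet s w k).toFinset

lemma prod_slotLR_obs {s : Fin L → Finset ℤ} (hs : ∀ i, ∀ t ∈ s i, t ≤ 0)
    (w : ℕ → SlotNoise L) (X : ℤ × Fin L → E) (n : ℕ) :
    ∏ k, N.slotLR (N.obs n (s, w, X) k) = ∏ x ∈ N.packets s w n, N.sampleLR x (X x) := by
  rw [packets, Finset.prod_biUnion]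
  · rw [← Fin.prod_univ_eq_prod_range
      (fun k => ∏ x ∈ (N.packet s w k).toFinset, N.sampleLR x (X x)) n]
    exact Finset.prod_congr rfl fun k _ => N.slotLR_obsAt s w X k
  · intro k _ m _ hkm
    refine Finset.disjoint_left.2 fun x hx hx' => hkm ?_
    rw [Option.mem_toFinset] at hx hx'
    exact N.packet_injective hs hx hx'

/-- `packet` does not see the measurements, so the set of coordinates revealed is fixed once `s` and
`w` are. This is what permits a change of measure in finitely many coordinates. -/
lemma dependsOn_obs (s : Fin L → Finset ℤ) (w : ℕ → SlotNoise L) (n : ℕ) :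
    DependsOn (fun X : ℤ × Fin L → E => N.obs n (s, w, X)) (N.packets s w n) := by
  intro X X' h
  funext k
  change N.obsAt (s, w, X) k = N.obsAt (s, w, X') k
  cases hp : N.packet s w k with
  | none => rw [N.obsAt_of_packet_eq_none hp, N.obsAt_of_packet_eq_none hp]
  | some x =>
    rw [N.obsAt_of_packet_eq_some hp, N.obsAt_of_packet_eq_some hp, h x]
    refine Finset.mem_coe.2 (Finset.mem_biUnion.2 ⟨k, Finset.mem_range.2 k.2, ?_⟩)
    simp [hp]

lemma measurable_prod_slotLR (n : ℕ) :
    Measurable fun y : Fin n → SlotObs L E => ∏ k, N.slotLR (y k) :=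
  Finset.measurable_prod _ fun k _ => N.measurable_slotLR.comp (measurable_pi_apply k)

/-- Condition on initial contents and noise, whose laws agree under both measures, and change
measure in the received coordinates only. The resulting product is a function of the observations
alone, by `prod_slotLR_obs`, hence a density for their law. -/
lemma obsLaw_zero_eq_withDensity
    (hac : ∀ i, (N.post i : Measure E) ≪ (N.pre i : Measure E))
    {init : PMF (Fin L → Finset ℤ)} (hinit : ∀ s ∈ init.support, ∀ i, ∀ t ∈ s i, t ≤ 0) (n : ℕ) :
    N.obsLaw init 0 n = (N.obsLaw init ⊤ n).withDensity fun y => ∏ k, N.slotLR (y k) := by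
  ext A hA
  have hm := N.measurable_prod_slotLR (L := L) n
  have h1 : Measurable (A.indicator (1 : (Fin n → SlotObs L E) → ℝ≥0∞)) :=
    measurable_one.indicator hA
  rw [withDensity_apply _ hA, ← lintegral_indicator hA, ← lintegral_indicator_one hA,
    obsLaw, obsLaw, lintegral_map h1 (N.measurable_obs n),
    lintegral_map (hm.indicator hA) (N.measurable_obs n),
    lintegral_law N init 0 (f := fun ω => A.indicator 1 (N.obs n ω))
      (h1.comp (N.measurable_obs n)),
    lintegral_law N init ⊤ (f := fun ω => A.indicator (fun y => ∏ k, N.slotLR (y k)) (N.obs n ω))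
      ((hm.indicator hA).comp (N.measurable_obs n))]
  refine lintegral_congr_ae ?_
  filter_upwards [ae_mem_support init] with s hs
  refine lintegral_congr fun w => ?_
  rw [lintegral_infinitePi_eq_lintegral_mul_prod (N.sampleLaw 0) (N.sampleLaw ⊤)
    N.measurable_sampleLR (N.packets s w n)
    (fun x _ => N.sampleLaw_zero_eq_withDensity hac x)
    (f := fun X => A.indicator 1 (N.obs n (s, w, X)))
    ((h1.comp (N.measurable_obs n)).comp (measurable_prodMk_left.comp measurable_prodMk_left))
    (fun X X' h => congrArg (A.indicator 1) (N.dependsOn_obs s w n h))]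
  refine lintegral_congr fun X => ?_
  rw [← N.prod_slotLR_obs (hinit s hs)]
  by_cases hmem : N.obs n (s, w, X) ∈ A <;> simp [hmem]

lemma ae_toReal_sampleLR_pos (hac : ∀ i, (N.post i : Measure E) ≪ (N.pre i : Measure E)) :
    ∀ᵐ X ∂Measure.infinitePi (N.sampleLaw 0), ∀ x, 0 < (N.sampleLR x (X x)).toReal := by
  refine ae_all_iff.2 fun x => ?_
  have h : ∀ᵐ z ∂N.sampleLaw 0 x, 0 < (N.sampleLR x z).toReal := by
    rw [sampleLaw_zero]
    unfold sampleLR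
    split_ifs
    · simp
    · filter_upwards [Measure.rnDeriv_pos (hac x.2),
        (hac x.2).ae_le (Measure.rnDeriv_ne_top (N.post x.2 : Measure E) (N.pre x.2))]
        with z h1 h2 using ENNReal.toReal_pos h1.ne' h2
  exact (measurePreserving_eval_infinitePi (N.sampleLaw 0) x).quasiMeasurePreserving.ae h

/-- The log-likelihood ratio contributed by one observation. -/
noncomputable def slotLLR (y : SlotObs L E) : ℝ := Real.log (N.slotLR y).toReal

lemma measurable_slotLLR : Measurable N.slotLLR :=
  Real.measurable_log.comp N.measurable_slotLR.ennreal_toReal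

/-- The logarithm of the product splits because, almost surely under the post-change law, every
single-sample ratio is positive and finite. -/
lemma logLR_ae_eq_sum (hac : ∀ i, (N.post i : Measure E) ≪ (N.pre i : Measure E))
    {init : PMF (Fin L → Finset ℤ)} (hinit : ∀ s ∈ init.support, ∀ i, ∀ t ∈ s i, t ≤ 0) (n : ℕ) :
    ∀ᵐ ω ∂N.law init 0,
      N.logLR init 0 n ω = ∑ k ∈ Finset.range n, N.slotLLR (N.obsAt ω k) := by
  have heq := N.obsLaw_zero_eq_withDensity hac hinit n
  have h1 : ∀ᵐ y ∂N.obsLaw init 0 n,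
      (N.obsLaw init 0 n).rnDeriv (N.obsLaw init ⊤ n) y = ∏ k, N.slotLR (y k) := by
    have h2 := Measure.rnDeriv_withDensity (N.obsLaw init ⊤ n) (N.measurable_prod_slotLR n)
    rw [← heq] at h2
    -- The density is identified almost everywhere for the pre-change law; absolute continuity
    -- transfers this to the post-change law.
    refine Measure.AbsolutelyContinuous.ae_le ?_ h2
    rw [heq]
    exact withDensity_absolutelyContinuous _ _
  have h3 := ae_of_ae_map (N.measurable_obs n).aemeasurable h1
  have h4 : ∀ᵐ ω ∂N.law init 0, ∀ x, 0 < (N.sampleLR x (ω.2.2 x)).toReal :=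
    (Measure.quasiMeasurePreserving_snd.comp Measure.quasiMeasurePreserving_snd).ae
      (N.ae_toReal_sampleLR_pos hac)
  filter_upwards [h3, h4] with ω h3 h4
  rw [logLR, llr, h3, ENNReal.toReal_prod, Real.log_prod,
    ← Fin.sum_univ_eq_sum_range (fun k => N.slotLLR (N.obsAt ω k)) n]
  · rfl
  · intro k _
    change (N.slotLR (N.obsAt (ω.1, ω.2.1, ω.2.2) k)).toReal ≠ 0
    rw [slotLR_obsAt, ENNReal.toReal_prod]
    exact Finset.prod_ne_zero_iff.2 fun x _ => (h4 x).ne'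

end Likelihood

end SensorNetwork

/-! ### Strong laws for log-likelihood ratios, including infinite means. -/

section StrongLaw

variable {ι Ω : Type*} [MeasurableSpace Ω]

/-- The strong law along identically distributed coordinates of an infinite product. -/
lemma strong_law_infinitePi (μ : ι → Measure Ω) [∀ x, IsProbabilityMeasure (μ x)]
    {σ : ℕ → ι} (hσ : σ.Injective) {ν : Measure Ω} (hν : ∀ k, μ (σ k) = ν)
    {f : Ω → ℝ} (hf : Measurable f) (hint : Integrable f ν) :
    ∀ᵐ X ∂Measure.infinitePi μ,
      Tendsto (fun n : ℕ => (∑ k ∈ Finset.range n, f (X (σ k))) / n) atTop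
        (𝓝 (∫ z, f z ∂ν)) := by
  have hmp : ∀ k, MeasurePreserving (fun X : ι → Ω => X (σ k)) (Measure.infinitePi μ) ν :=
    fun k => hν k ▸ measurePreserving_eval_infinitePi μ (σ k)
  have hmap : ∀ k, (Measure.infinitePi μ).map (fun X => f (X (σ k))) = ν.map f := fun k => by
    rw [← (hmp k).map_eq, Measure.map_map hf (hmp k).measurable]
    rfl
  have h := strong_law_ae_real (μ := Measure.infinitePi μ) (fun k X => f (X (σ k)))
    ((hmp 0).integrable_comp_of_integrable hint)
    (fun k m hkm => ((iIndepFun_infinitePi (P := μ) (X := fun _ => f) fun _ => hf).precomp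
      hσ).indepFun hkm)
    (fun k => ⟨(hf.comp (hmp k).measurable).aemeasurable,
      (hf.comp (hmp 0).measurable).aemeasurable, by rw [hmap, hmap]⟩)
  have h0 : ∫ X, f (X (σ 0)) ∂Measure.infinitePi μ = ∫ z, f z ∂ν := by
    rw [← (hmp 0).map_eq, integral_map (hmp 0).measurable.aemeasurable
      hf.aestronglyMeasurable]
  rwa [h0] at h

/-- If the integrals of the truncations were bounded, monotone convergence would make the positive
part integrable, and with it `f`. -/
lemma exists_lt_integral_min_of_not_integrable {ν : Measure Ω} [IsProbabilityMeasure ν]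
    {f : Ω → ℝ} (hf : Measurable f) (hneg : Integrable (fun z => max (-f z) 0) ν)
    (hnot : ¬ Integrable f ν) :
    (∀ M : ℕ, Integrable (fun z => min (f z) M) ν) ∧
      ∀ b : ℝ, ∃ M : ℕ, b < ∫ z, min (f z) M ∂ν := by
  have hpos : ∀ M : ℕ, Integrable (fun z => min (max (f z) 0) (M : ℝ)) ν := fun M =>
    Integrable.of_bound ((hf.max measurable_const).min measurable_const).aestronglyMeasurable M
      (ae_of_all _ fun z => by
        rw [Real.norm_of_nonneg (le_min (le_max_right _ _) (Nat.cast_nonneg _))]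
        exact min_le_right _ _)
  have hdec : ∀ M : ℕ, (fun z => min (f z) (M : ℝ)) =
      fun z => min (max (f z) 0) (M : ℝ) - max (-f z) 0 := fun M => by
    funext z
    have hM : (0 : ℝ) ≤ M := Nat.cast_nonneg _
    rcases le_total (f z) 0 with h | h
    · rw [max_eq_right h, max_eq_left (neg_nonneg.2 h), min_eq_left hM,
        min_eq_left (h.trans hM)]
      ring
    · rw [max_eq_left h, max_eq_right (neg_nonpos.2 h), sub_zero]
  refine ⟨fun M => by rw [hdec]; exact (hpos M).sub hneg, fun b => ?_⟩
  by_contra! hb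
  have hle : ∀ M : ℕ, ∫⁻ z, ENNReal.ofReal (min (max (f z) 0) (M : ℝ)) ∂ν ≤
      ENNReal.ofReal (b + ∫ z, max (-f z) 0 ∂ν) := fun M => by
    rw [← ofReal_integral_eq_lintegral_ofReal (hpos M)
      (ae_of_all _ fun z => le_min (le_max_right _ _) (Nat.cast_nonneg _))]
    refine ENNReal.ofReal_le_ofReal ?_
    have := hb M
    rw [hdec, integral_sub (hpos M) hneg] at this
    linarith
  have hlim : Tendsto (fun M : ℕ => ∫⁻ z, ENNReal.ofReal (min (max (f z) 0) (M : ℝ)) ∂ν) atTop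
      (𝓝 (∫⁻ z, ENNReal.ofReal (max (f z) 0) ∂ν)) := by
    refine lintegral_tendsto_of_tendsto_of_monotone
      (fun M => ((hf.max measurable_const).min measurable_const).ennreal_ofReal.aemeasurable)
      (ae_of_all _ fun z M M' h => ENNReal.ofReal_le_ofReal
        (min_le_min le_rfl (by exact_mod_cast h)))
      (ae_of_all _ fun z => tendsto_const_nhds.congr' ?_)
    filter_upwards [eventually_ge_atTop ⌈max (f z) 0⌉₊] with M hM
    rw [min_eq_left (Nat.ceil_le.1 hM)]
  have hfin : ∫⁻ z, ENNReal.ofReal (max (f z) 0) ∂ν < ∞ :=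
    (le_of_tendsto' hlim hle).trans_lt ENNReal.ofReal_lt_top
  have hp : Integrable (fun z => max (f z) 0) ν :=
    (lintegral_ofReal_ne_top_iff_integrable (hf.max measurable_const).aestronglyMeasurable
      (ae_of_all _ fun z => le_max_right _ _)).1 hfin.ne
  refine hnot ((hp.sub hneg).congr (ae_of_all _ fun z => ?_))
  exact max_zero_sub_max_neg_zero_eq_self (f z)

/-- The averages dominate those of each truncation `min f M`, whose limits exceed any given bound
for suitable `M`. -/
lemma strong_law_infinitePi_atTop (μ : ι → Measure Ω) [∀ x, IsProbabilityMeasure (μ x)]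
    {σ : ℕ → ι} (hσ : σ.Injective) {ν : Measure Ω} (hν : ∀ k, μ (σ k) = ν)
    {f : Ω → ℝ} (hf : Measurable f) (hneg : Integrable (fun z => max (-f z) 0) ν)
    (hnot : ¬ Integrable f ν) :
    ∀ᵐ X ∂Measure.infinitePi μ,
      Tendsto (fun n : ℕ => (∑ k ∈ Finset.range n, f (X (σ k))) / n) atTop atTop := by
  have : IsProbabilityMeasure ν := hν 0 ▸ inferInstance
  obtain ⟨h1, h2⟩ := exists_lt_integral_min_of_not_integrable hf hneg hnot
  filter_upwards [ae_all_iff.2 fun M : ℕ => strong_law_infinitePi μ hσ hν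
    (hf.min measurable_const) (h1 M)] with X hX
  refine tendsto_atTop.2 fun b => ?_
  obtain ⟨M, hM⟩ := h2 b
  filter_upwards [(hX M).eventually_const_lt hM] with n hn
  refine hn.le.trans (div_le_div_of_nonneg_right ?_ (Nat.cast_nonneg _))
  exact Finset.sum_le_sum fun k _ => min_le_left _ _

/-- Passing to `ν` turns the integrand into the positive part of `-r log r`, where `r` is the
density; it is at most one because `log r ≥ 1 - 1/r`. Thus the mean of the log-likelihood ratio can
diverge only to `+∞`. -/
lemma integrable_max_neg_llr {μ ν : Measure Ω} [IsProbabilityMeasure μ] [IsProbabilityMeasure ν]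
    (h : μ ≪ ν) : Integrable (fun z => max (-llr μ ν z) 0) μ := by
  have hm : Measurable fun z => max (-llr μ ν z) 0 :=
    (measurable_llr μ ν).neg.max measurable_const
  refine (lintegral_ofReal_ne_top_iff_integrable hm.aestronglyMeasurable
    (ae_of_all _ fun z => le_max_right _ _)).1 (ne_of_lt ?_)
  rw [← lintegral_rnDeriv_mul h hm.ennreal_ofReal.aemeasurable]
  refine lt_of_le_of_lt (lintegral_mono_ae (g := fun _ => 1) ?_) (by simp)
  filter_upwards [Measure.rnDeriv_ne_top μ ν] with z hz
  rw [← ENNReal.ofReal_toReal hz, ← ENNReal.ofReal_mul ENNReal.toReal_nonneg,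
    ← ENNReal.ofReal_one]
  refine ENNReal.ofReal_le_ofReal ?_
  rw [llr]
  set r := (μ.rnDeriv ν z).toReal
  have hr : 0 ≤ r := ENNReal.toReal_nonneg
  rcases hr.eq_or_lt with h0 | h0
  · simp [← h0]
  rw [mul_max_of_nonneg _ _ hr, mul_zero]
  refine max_le ?_ zero_le_one
  have h1 := mul_le_mul_of_nonneg_left (Real.one_sub_inv_le_log_of_pos h0) hr
  rw [mul_sub, mul_inv_cancel₀ h0.ne'] at h1
  linarith

/-- The average log-likelihood ratio of independent samples tends to the Kullback–Leibler
divergence, finite or not. -/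
lemma strong_law_llr (μ : ι → Measure Ω) [∀ x, IsProbabilityMeasure (μ x)]
    {σ : ℕ → ι} (hσ : σ.Injective) {ν₁ ν₀ : Measure Ω} [IsProbabilityMeasure ν₁]
    [IsProbabilityMeasure ν₀] (hν : ∀ k, μ (σ k) = ν₁) (h : ν₁ ≪ ν₀) :
    ∀ᵐ X ∂Measure.infinitePi μ,
      Tendsto (fun n : ℕ =>
        (((∑ k ∈ Finset.range n, llr ν₁ ν₀ (X (σ k))) / n : ℝ) : EReal)) atTop
        (𝓝 (klDiv ν₁ ν₀ : EReal)) := by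
  by_cases hint : Integrable (llr ν₁ ν₀) ν₁
  · filter_upwards [strong_law_infinitePi μ hσ hν (measurable_llr ν₁ ν₀) hint] with X hX
    -- The mass correction in `klDiv` vanishes for two probability measures.
    rw [← toReal_klDiv_of_measure_eq h (by simp)] at hX
    rw [← ENNReal.ofReal_toReal (klDiv_ne_top h hint),
      EReal.coe_ennreal_ofReal, max_eq_left ENNReal.toReal_nonneg]
    exact EReal.tendsto_coe.2 hX
  · rw [klDiv_of_not_integrable hint, EReal.coe_ennreal_top]
    filter_upwards [strong_law_infinitePi_atTop μ hσ hν (measurable_llr ν₁ ν₀)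
      (integrable_max_neg_llr h) hint] with X hX
    exact EReal.tendsto_coe_nhds_top_iff.2 hX

end StrongLaw

/-! ### Limits in `EReal`, the pathwise queue bound, and reindexing by counting. -/

section Limits

/-- Positivity of `r` excludes the indeterminate product of zero and infinity. -/
lemma tendsto_coe_mul_of_pos {c a : ℕ → ℝ} {r : ℝ} (hr : 0 < r) {d : ℝ≥0∞}
    (hc : Tendsto c atTop (𝓝 r))
    (ha : Tendsto (fun n => (a n : EReal)) atTop (𝓝 (d : EReal))) :
    Tendsto (fun n => ((c n * a n : ℝ) : EReal)) atTop
      (𝓝 ((ENNReal.ofReal r * d : ℝ≥0∞) : EReal)) := by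
  induction d with
  | top =>
    rw [EReal.coe_ennreal_top, EReal.tendsto_coe_nhds_top_iff] at ha
    rw [ENNReal.mul_top (by simpa using hr), EReal.coe_ennreal_top,
      EReal.tendsto_coe_nhds_top_iff]
    exact hc.pos_mul_atTop hr ha
  | coe d =>
    have h : ((ENNReal.ofReal r * (d : ℝ≥0∞) : ℝ≥0∞) : EReal) = ((r * d : ℝ) : EReal) := by
      rw [EReal.coe_ennreal_mul, EReal.coe_ennreal_ofReal, max_eq_left hr.le, EReal.coe_mul]
      rfl
    rw [h]
    have ha' : Tendsto a atTop (𝓝 (d : ℝ)) := EReal.tendsto_coe.1 ha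
    exact EReal.tendsto_coe.2 (hc.mul ha')

lemma tendsto_coe_sum {κ : Type*} (s : Finset κ) {a : κ → ℕ → ℝ} {d : κ → ℝ≥0∞}
    (h : ∀ i ∈ s, Tendsto (fun n => (a i n : EReal)) atTop (𝓝 (d i : EReal))) :
    Tendsto (fun n => ((∑ i ∈ s, a i n : ℝ) : EReal)) atTop
      (𝓝 ((∑ i ∈ s, d i : ℝ≥0∞) : EReal)) := by
  classical
  induction s using Finset.induction_on with
  | empty => simp
  | insert i s hi ih =>
    simp only [Finset.sum_insert hi, EReal.coe_add, EReal.coe_ennreal_add]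
    exact (EReal.continuousAt_add (p := ((d i : EReal), ((∑ i ∈ s, d i : ℝ≥0∞) : EReal)))
      (Or.inr (EReal.coe_ennreal_ne_bot _)) (Or.inl (EReal.coe_ennreal_ne_bot _))).tendsto.comp
      ((h i (Finset.mem_insert_self _ _)).prodMk_nhds
        (ih fun j hj => h j (Finset.mem_insert_of_mem hj)))

/-- A single-server queue whose arrival rate does not exceed its service rate grows
sublinearly. -/
lemma tendsto_queue_div_zero {W a σ : ℕ → ℝ} {C ρ p : ℝ} (hρp : ρ ≤ p) (hW : ∀ n, 0 ≤ W n)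
    (haC : ∀ n, a n ≤ C) (h0 : ∀ n, W n = 0 → W (n + 1) = a n)
    (h1 : ∀ n, W n ≠ 0 → W (n + 1) + σ n = W n + a n)
    (ha : Tendsto (fun n : ℕ => (∑ k ∈ Finset.range n, a k) / n) atTop (𝓝 ρ))
    (hσ : Tendsto (fun n : ℕ => (∑ k ∈ Finset.range n, σ k) / n) atTop (𝓝 p)) :
    Tendsto (fun n => W n / n) atTop (𝓝 0) := by
  -- The net input, recentred by its asymptotic drift so that `B n / n` tends to zero. While the
  -- queue is busy, `W` grows by no more than `B` does, since `ρ ≤ p`.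
  set B : ℕ → ℝ := fun n => ∑ k ∈ Finset.range n, a k - ∑ k ∈ Finset.range n, σ k +
    (p - ρ) * n with hB
  have hBlim : Tendsto (fun n : ℕ => B n / n) atTop (𝓝 0) := by
    have h := (ha.sub hσ).add_const (p - ρ)
    rw [show ρ - p + (p - ρ) = 0 by ring] at h
    refine h.congr' ?_
    filter_upwards [eventually_gt_atTop 0] with n hn
    have : (n : ℝ) ≠ 0 := by exact_mod_cast hn.ne'
    simp only [hB]
    field_simp
  refine Metric.tendsto_atTop.2 fun ε hε => ?_
  obtain ⟨K, hK⟩ := Metric.tendsto_atTop.1 hBlim (ε / 3) (by positivity)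
  have hBK : ∀ n ≥ K, |B n| ≤ ε / 3 * n := fun n hn => by
    rcases Nat.eq_zero_or_pos n with rfl | hpos
    · simp [hB]
    have h := (hK n hn).le
    have hn' : (0 : ℝ) < n := by exact_mod_cast hpos
    rwa [Real.dist_eq, sub_zero, abs_div, abs_of_pos hn', div_le_iff₀ hn'] at h
  -- The second entry starts the induction at `K`; the first covers a restart from an empty queue,
  -- where `B n + ε / 3 * n ≥ 0` leaves only one arrival batch to absorb.
  set C' := max C (W K - B K - ε / 3 * K) with hC'
  have key : ∀ n ≥ K, W n ≤ B n + ε / 3 * n + C' := by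
    intro n hn
    induction n, hn using Nat.le_induction with
    | base => linarith [le_max_right C (W K - B K - ε / 3 * K)]
    | succ n hn ih =>
      by_cases hz : W n = 0
      · rw [h0 n hz]
        have := neg_le_of_abs_le (hBK (n + 1) (hn.trans n.le_succ))
        linarith [haC n, le_max_left C (W K - B K - ε / 3 * K)]
      · have h2 : B (n + 1) = B n + a n - σ n + (p - ρ) := by
          simp only [hB, Finset.sum_range_succ]
          push_cast
          ring
        have h3 := h1 n hz
        push_cast
        linarith
  obtain ⟨K', hK'⟩ := exists_nat_gt (C' / (ε / 3))
  refine ⟨max (max K K') 1, fun n hn => ?_⟩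
  have hn1 : (0 : ℝ) < n := by
    exact_mod_cast (le_max_right _ _).trans hn
  have hnK : K ≤ n := ((le_max_left _ _).trans (le_max_left _ _)).trans hn
  have hnK' : (K' : ℝ) ≤ n := by
    exact_mod_cast ((le_max_right _ _).trans (le_max_left _ _)).trans hn
  rw [Real.dist_eq, sub_zero, abs_of_nonneg (div_nonneg (hW n) hn1.le), div_lt_iff₀ hn1]
  have h4 : C' < ε / 3 * n := by
    have := hK'.trans_le hnK'
    rw [div_lt_iff₀ (by positivity)] at this
    linarith
  linarith [key n hnK, le_of_abs_le (hBK n hnK)]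

lemma sum_range_ite_eq_sum_range_count {M : Type*} [AddCommMonoid M] (p : ℕ → Prop)
    [DecidablePred p] (f : ℕ → M) (n : ℕ) :
    ∑ k ∈ Finset.range n, (if p k then f k else 0) =
      ∑ m ∈ Finset.range (Nat.count p n), f (Nat.nth p m) := by
  induction n with
  | zero => simp
  | succ n ih =>
    rw [Finset.sum_range_succ, ih, Nat.count_succ]
    split_ifs with h
    · rw [Finset.sum_range_succ, Nat.nth_count h]
    · simp

lemma infinite_of_tendsto_count_div {p : ℕ → Prop} [DecidablePred p] {r : ℝ} (hr : 0 < r)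
    (h : Tendsto (fun n : ℕ => (Nat.count p n : ℝ) / n) atTop (𝓝 r)) :
    (Set.ofPred p).Infinite := by
  intro hfin
  refine hr.ne (tendsto_nhds_unique (squeeze_zero (fun n => by positivity) (fun n =>
    div_le_div_of_nonneg_right (Nat.cast_le.2 (Nat.count_le_card hfin n)) (Nat.cast_nonneg _))
    (tendsto_const_div_atTop_nhds_zero_nat _)) h)

end Limits

namespace SensorNetwork

/-! ### Frequency of post-change packets and the information rate. -/

section Rate

variable {L : ℕ} {E : Type*} [MeasurableSpace E] (N : SensorNetwork L E)

/-- In slot `k + 1` a post-change packet of sensor `i` is received. -/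
def FreshFrom (s : Fin L → Finset ℤ) (w : ℕ → SlotNoise L) (i : Fin L) (k : ℕ) : Prop :=
  delivered (w k) (fun j => (N.queuePath s w k j).card) = some i ∧
    0 < N.discipline i (N.queuePath s w k i)

instance (s : Fin L → Finset ℤ) (w : ℕ → SlotNoise L) (i : Fin L) :
    DecidablePred (N.FreshFrom s w i) := fun k => by
  unfold FreshFrom; infer_instance

lemma packet_of_freshFrom {s : Fin L → Finset ℤ} {w : ℕ → SlotNoise L} {i : Fin L} {k : ℕ}
    (h : N.FreshFrom s w i k) :
    N.packet s w k = some (N.discipline i (N.queuePath s w k i), i) :=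
  N.packet_eq_some_iff.2 ⟨h.1, rfl⟩

/-- One balance serves two purposes: `P = True` ties the contents to the length chain, and `P = (0 <
·)` counts post-change samples. The incoming stamp is new to the queue, so the union is disjoint. -/
lemma card_filter_queuePath_succ {s : Fin L → Finset ℤ} (hs : ∀ i, ∀ t ∈ s i, t ≤ 0)
    (w : ℕ → SlotNoise L) (k : ℕ) (i : Fin L) (P : ℤ → Prop) [DecidablePred P]
    (hP : P ((k : ℤ) + 1)) :
    ((N.queuePath s w (k + 1) i).filter P).card +
        (if delivered (w k) (fun j => (N.queuePath s w k j).card) = some i ∧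
          P (N.discipline i (N.queuePath s w k i)) then 1 else 0) =
      ((N.queuePath s w k i).filter P).card + if (w k).1 i then 1 else 0 := by
  set Q := N.queuePath s w k i with hQ
  have hnot : (k : ℤ) + 1 ∉ Q := fun h => by
    have := N.le_of_mem_queuePath hs w k ((k : ℤ) + 1, i) h
    simp at this
  set A := if delivered (w k) (fun j => (N.queuePath s w k j).card) = some i
    then Q.erase (N.discipline i Q) else Q with hA
  have hAQ : A ⊆ Q := by
    rw [hA]; split_ifs
    exacts [Finset.erase_subset _ _, subset_rfl]
  have hsucc : N.queuePath s w (k + 1) i = A ∪ if (w k).1 i then {(k : ℤ) + 1} else ∅ := rfl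
  have h1 : (A.filter P).card + (if delivered (w k) (fun j => (N.queuePath s w k j).card) = some i
      ∧ P (N.discipline i Q) then 1 else 0) = (Q.filter P).card := by
    by_cases hd : delivered (w k) (fun j => (N.queuePath s w k j).card) = some i
    · have hmem : N.discipline i Q ∈ Q := N.mem_queuePath_of_packet
        (x := (N.discipline i Q, i)) (N.packet_eq_some_iff.2 ⟨hd, rfl⟩)
      rw [hA, if_pos hd, Finset.filter_erase]
      by_cases hp : P (N.discipline i Q)
      · rw [if_pos ⟨hd, hp⟩, Finset.card_erase_add_one (Finset.mem_filter.2 ⟨hmem, hp⟩)]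
      · rw [if_neg fun h => hp h.2, Finset.erase_eq_of_notMem fun h =>
          hp (Finset.mem_filter.1 h).2, add_zero]
    · rw [hA, if_neg hd, if_neg fun h => hd h.1, add_zero]
  have h2 : ((N.queuePath s w (k + 1) i).filter P).card =
      (A.filter P).card + if (w k).1 i then 1 else 0 := by
    rw [hsucc]
    split_ifs with hw
    · rw [Finset.filter_union, Finset.card_union_of_disjoint]
      · simp [Finset.filter_singleton, hP]
      · refine Finset.disjoint_left.2 fun t ht ht' => hnot ?_
        rw [Finset.mem_filter, Finset.mem_singleton] at ht'
        exact ht'.1 ▸ hAQ (Finset.mem_filter.1 ht).1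
    · simp
  omega

lemma card_queuePath_succ {s : Fin L → Finset ℤ} (hs : ∀ i, ∀ t ∈ s i, t ≤ 0)
    (w : ℕ → SlotNoise L) (k : ℕ) (i : Fin L) :
    (N.queuePath s w (k + 1) i).card =
      lengthStep (w k) (fun j => (N.queuePath s w k j).card) i := by
  have h1 := N.card_filter_queuePath_succ hs w k i (fun _ => True) trivial
  have h2 := lengthStep_add (w k) (fun j => (N.queuePath s w k j).card) i
  simp only [Finset.filter_true, and_true] at h1
  omega

/-- Conservation: each sample taken from slot `1` on is either still waiting or has been received.
-/
lemma card_fresh_add_count {s : Fin L → Finset ℤ} (hs : ∀ i, ∀ t ∈ s i, t ≤ 0)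
    (w : ℕ → SlotNoise L) (i : Fin L) (n : ℕ) :
    ((N.queuePath s w n i).filter (0 < ·)).card + Nat.count (N.FreshFrom s w i) n =
      ∑ k ∈ Finset.range n, if (w k).1 i then 1 else 0 := by
  induction n with
  | zero =>
    simp only [queuePath, Nat.count_zero, Finset.range_zero, Finset.sum_empty, add_zero,
      Finset.card_eq_zero, Finset.filter_eq_empty_iff, not_lt]
    exact fun t ht => hs i t ht
  | succ n ih =>
    have h := N.card_filter_queuePath_succ hs w n i (0 < ·) (by positivity)
    rw [Finset.sum_range_succ, ← ih, Nat.count_succ]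
    simp only [FreshFrom]
    omega

/-- Long-run frequencies of sampling and of channel availability. -/
def Regular (w : ℕ → SlotNoise L) : Prop :=
  (∀ i, Tendsto (fun n : ℕ => (∑ k ∈ Finset.range n, if (w k).1 i then (1 : ℝ) else 0) / n) atTop
    (𝓝 (N.rate i))) ∧
  Tendsto (fun n : ℕ => (∑ k ∈ Finset.range n, if (w k).2.1 then (1 : ℝ) else 0) / n) atTop
    (𝓝 N.success)

lemma ae_tendsto_frequency (A : Set (SlotNoise L)) [DecidablePred (· ∈ A)] :
    ∀ᵐ w ∂Measure.infinitePi (fun _ : ℕ => N.slotLaw),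
      Tendsto (fun n : ℕ => (∑ k ∈ Finset.range n, if w k ∈ A then (1 : ℝ) else 0) / n) atTop
        (𝓝 (N.slotLaw.real A)) := by
  have hA : MeasurableSet A := .of_discrete
  have h := strong_law_infinitePi (fun _ : ℕ => N.slotLaw) Function.injective_id
    (ν := N.slotLaw) (fun _ => rfl) (f := A.indicator 1) (.of_discrete)
    ((integrable_const (1 : ℝ)).indicator hA)
  rw [integral_indicator_one hA] at h
  filter_upwards [h] with w hw
  simpa [Set.indicator_apply] using hw

lemma ae_regular : ∀ᵐ w ∂Measure.infinitePi (fun _ : ℕ => N.slotLaw), N.Regular w := by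
  refine Filter.Eventually.and (ae_all_iff.2 fun i => ?_) ?_
  · have h := N.ae_tendsto_frequency {w | w.1 i = true}
    rw [measureReal_def, slotLaw_sampled, ENNReal.toReal_ofReal (N.rate i).2.1] at h
    exact h
  · have h := N.ae_tendsto_frequency {w | w.2.1 = true}
    rw [measureReal_def, slotLaw_success, ENNReal.toReal_ofReal N.success.2.1] at h
    exact h

lemma tendsto_totalLength_div {s : Fin L → Finset ℤ} (hs : ∀ i, ∀ t ∈ s i, t ≤ 0)
    {w : ℕ → SlotNoise L} (hw : N.Regular w)
    (hstable : ∑ i, (N.rate i : ℝ) < (N.success : ℝ)) :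
    Tendsto (fun n : ℕ => ((∑ i, (N.queuePath s w n i).card : ℕ) : ℝ) / n) atTop (𝓝 0) := by
  refine tendsto_queue_div_zero (a := fun k => ∑ i, if (w k).1 i then (1 : ℝ) else 0)
    (σ := fun k => if (w k).2.1 then (1 : ℝ) else 0) (C := L) hstable.le
    (fun n => Nat.cast_nonneg _) (fun n => ?_) (fun n h => ?_) (fun n h => ?_) ?_ hw.2
  · refine (Finset.sum_le_card_nsmul Finset.univ _ 1 fun i _ => ?_).trans (by simp)
    split_ifs <;> norm_num
  · have h0 : (fun j => (N.queuePath s w n j).card) = 0 := by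
      funext j
      have h' : ∑ i, (N.queuePath s w n i).card = 0 := by exact_mod_cast h
      exact Finset.sum_eq_zero_iff.1 h' j (Finset.mem_univ j)
    simp only [N.card_queuePath_succ hs, h0, lengthStep_zero]
    push_cast
    rfl
  · have h0 : (fun j => (N.queuePath s w n j).card) ≠ 0 := fun h0 => h (by
      have := congrArg (fun q : Fin L → ℕ => ∑ i, q i) h0
      exact_mod_cast this.trans (by simp))
    have h1 := sum_lengthStep_add (w n) h0
    simp only [N.card_queuePath_succ hs]
    exact_mod_cast h1
  · have h := tendsto_finsetSum Finset.univ fun i _ => hw.1 i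
    refine h.congr fun n => ?_
    rw [Finset.sum_comm, Finset.sum_div]

/-- The post-change samples still waiting are at most the total queue length, which is `o(n)`; so
receptions have the same frequency as samplings, whatever the discipline. -/
lemma tendsto_count_freshFrom_div {s : Fin L → Finset ℤ} (hs : ∀ i, ∀ t ∈ s i, t ≤ 0)
    {w : ℕ → SlotNoise L} (hw : N.Regular w)
    (hstable : ∑ i, (N.rate i : ℝ) < (N.success : ℝ)) (i : Fin L) :
    Tendsto (fun n : ℕ => (Nat.count (N.FreshFrom s w i) n : ℝ) / n) atTop (𝓝 (N.rate i)) := by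
  have h1 : Tendsto (fun n : ℕ => (((N.queuePath s w n i).filter (0 < ·)).card : ℝ) / n) atTop
      (𝓝 0) := by
    refine squeeze_zero (fun n => by positivity) (fun n => ?_)
      (N.tendsto_totalLength_div hs hw hstable)
    refine div_le_div_of_nonneg_right (Nat.cast_le.2 ?_) (Nat.cast_nonneg _)
    exact (Finset.card_filter_le _ _).trans (Finset.single_le_sum
      (f := fun i => (N.queuePath s w n i).card) (fun _ _ => Nat.zero_le _) (Finset.mem_univ i))
  have h2 := (hw.1 i).sub h1
  rw [sub_zero] at h2
  refine h2.congr fun n => ?_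
  have h3 : ((((N.queuePath s w n i).filter (0 < ·)).card : ℕ) : ℝ) +
      Nat.count (N.FreshFrom s w i) n = ∑ k ∈ Finset.range n, if (w k).1 i then (1 : ℝ) else 0 := by
    exact_mod_cast N.card_fresh_add_count hs w i n
  rw [← h3, ← sub_div, add_sub_cancel_left]

/-- The packet received in the `m`-th slot with a post-change packet of sensor `i`. -/
noncomputable def freshPacket (s : Fin L → Finset ℤ) (w : ℕ → SlotNoise L) (i : Fin L) (m : ℕ) :
    ℤ × Fin L :=
  (N.discipline i (N.queuePath s w (Nat.nth (N.FreshFrom s w i) m) i), i)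

lemma slotLLR_obsAt (s : Fin L → Finset ℤ) (w : ℕ → SlotNoise L) (X : ℤ × Fin L → E) (k : ℕ) :
    N.slotLLR (N.obsAt (s, w, X) k) =
      ∑ i, if N.FreshFrom s w i k then
        llr (N.post i : Measure E) (N.pre i) (X (N.discipline i (N.queuePath s w k i), i))
        else 0 := by
  rw [slotLLR, slotLR_obsAt]
  cases hp : N.packet s w k with
  | none =>
    have h : ∀ i, ¬ N.FreshFrom s w i k := fun i hi => by
      have := N.packet_of_freshFrom hi
      rw [hp] at this
      simp at this
    simp [h]
  | some x =>
    obtain ⟨h1, h2⟩ := N.packet_eq_some_iff.1 hp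
    rw [Finset.sum_eq_single x.2]
    · simp only [FreshFrom, h1, h2, true_and, Option.toFinset_some, Finset.prod_singleton,
        sampleLR]
      by_cases hx : 0 < x.1
      · rw [if_neg (not_le.2 hx), if_pos hx]
        rfl
      · rw [if_pos (not_lt.1 hx), if_neg hx]
        simp
    · intro i _ hi
      refine if_neg fun h => hi ?_
      exact Option.some.inj (h.1.symm.trans h1)
    · exact fun h => absurd (Finset.mem_univ _) h

/-- Separates the frequency of reception, a function of the noise, from the average over received
packets. When nothing has been received, the convention for division by zero makes both sides agree.
-/
lemma sum_slotLLR_div (s : Fin L → Finset ℤ) (w : ℕ → SlotNoise L) (X : ℤ × Fin L → E) (n : ℕ) :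
    (∑ k ∈ Finset.range n, N.slotLLR (N.obsAt (s, w, X) k)) / n =
      ∑ i, (Nat.count (N.FreshFrom s w i) n : ℝ) / n *
        ((∑ m ∈ Finset.range (Nat.count (N.FreshFrom s w i) n),
          llr (N.post i : Measure E) (N.pre i) (X (N.freshPacket s w i m))) /
            (Nat.count (N.FreshFrom s w i) n : ℕ)) := by
  simp only [slotLLR_obsAt]
  rw [Finset.sum_comm, Finset.sum_div]
  refine Finset.sum_congr rfl fun i _ => ?_
  rw [sum_range_ite_eq_sum_range_count (N.FreshFrom s w i) fun k =>
    llr (N.post i : Measure E) (N.pre i) (X (N.discipline i (N.queuePath s w k i), i))]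
  by_cases h : Nat.count (N.FreshFrom s w i) n = 0
  · simp [h]
  · have h' : (Nat.count (N.FreshFrom s w i) n : ℝ) ≠ 0 := by exact_mod_cast h
    rw [div_mul_div_comm, mul_comm (n : ℝ), mul_div_mul_left _ _ h']
    rfl

lemma ae_tendsto_sum_slotLLR_div (hrate : ∀ i, 0 < (N.rate i : ℝ))
    (hstable : ∑ i, (N.rate i : ℝ) < (N.success : ℝ))
    (hac : ∀ i, (N.post i : Measure E) ≪ (N.pre i : Measure E))
    {s : Fin L → Finset ℤ} (hs : ∀ i, ∀ t ∈ s i, t ≤ 0)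
    {w : ℕ → SlotNoise L} (hw : N.Regular w) :
    ∀ᵐ X ∂Measure.infinitePi (N.sampleLaw 0),
      Tendsto (fun n : ℕ =>
        (((∑ k ∈ Finset.range n, N.slotLLR (N.obsAt (s, w, X) k)) / n : ℝ) : EReal)) atTop
        (𝓝 ((∑ i, ENNReal.ofReal (N.rate i) *
            klDiv (N.post i : Measure E) (N.pre i : Measure E) : ℝ≥0∞) : EReal)) := by
  have hcount := N.tendsto_count_freshFrom_div hs hw hstable
  have hinf := fun i => infinite_of_tendsto_count_div (hrate i) (hcount i)
  have hfresh := fun i m => Nat.nth_mem_of_infinite (hinf i) m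
  -- With `s` and `w` fixed this is a deterministic enumeration of distinct coordinates, so the
  -- received measurements are independent with the post-change law.
  have hσ : ∀ i, Function.Injective (N.freshPacket s w i) := fun i m m' h =>
    Nat.nth_injective (hinf i) (N.packet_injective hs (N.packet_of_freshFrom (hfresh i m))
      ((N.packet_of_freshFrom (hfresh i m')).trans (congrArg some h.symm)))
  have hν : ∀ i m, N.sampleLaw 0 (N.freshPacket s w i m) = N.post i := fun i m => by
    rw [sampleLaw_zero]
    exact if_neg (not_le.2 (hfresh i m).2)
  filter_upwards [ae_all_iff.2 fun i => strong_law_llr (N.sampleLaw 0) (hσ i) (hν i) (hac i)]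
    with X hX
  simp only [sum_slotLLR_div]
  refine tendsto_coe_sum _ fun i _ => tendsto_coe_mul_of_pos (hrate i) (hcount i) ?_
  -- The averages run over the number of packets received so far, so the strong law is composed with
  -- a counter tending to infinity.
  refine (hX i).comp (tendsto_atTop.2 fun b => ?_)
  filter_upwards [eventually_ge_atTop (Nat.nth (N.FreshFrom s w i) b)] with n hn
  calc b = Nat.count (N.FreshFrom s w i) (Nat.nth (N.FreshFrom s w i) b) :=
        (Nat.count_nth_of_infinite (hinf i) b).symm
    _ ≤ _ := Nat.count_monotone _ hn

lemma law_ae_tendsto_sum_slotLLR_div (hrate : ∀ i, 0 < (N.rate i : ℝ))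
    (hstable : ∑ i, (N.rate i : ℝ) < (N.success : ℝ))
    (hac : ∀ i, (N.post i : Measure E) ≪ (N.pre i : Measure E))
    {init : PMF (Fin L → Finset ℤ)} (hinit : ∀ s ∈ init.support, ∀ i, ∀ t ∈ s i, t ≤ 0) :
    ∀ᵐ ω ∂N.law init 0,
      Tendsto (fun n : ℕ =>
        (((∑ k ∈ Finset.range n, N.slotLLR (N.obsAt ω k)) / n : ℝ) : EReal)) atTop
        (𝓝 ((∑ i, ENNReal.ofReal (N.rate i) *
            klDiv (N.post i : Measure E) (N.pre i : Measure E) : ℝ≥0∞) : EReal)) := by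
  -- Measurability of the convergence event allows the almost-sure statement to be checked section
  -- by section.
  have hmeas := measurableSet_tendsto
    (𝓝 ((∑ i, ENNReal.ofReal (N.rate i) *
      klDiv (N.post i : Measure E) (N.pre i : Measure E) : ℝ≥0∞) : EReal)) (l := atTop)
    (f := fun (n : ℕ) (ω : Outcome L E) =>
      (((∑ k ∈ Finset.range n, N.slotLLR (N.obsAt ω k)) / n : ℝ) : EReal))
    (fun n => measurable_coe_real_ereal.comp ((Finset.measurable_sum _ fun k _ =>
      N.measurable_slotLLR.comp (N.measurable_obsAt k)).div_const _))
  rw [law, Measure.ae_prod_iff_ae_ae hmeas]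
  filter_upwards [ae_mem_support init] with s hs
  refine (Measure.ae_prod_iff_ae_ae (measurable_prodMk_left (x := s) hmeas)).2 ?_
  filter_upwards [N.ae_regular] with w hw
  exact N.ae_tendsto_sum_slotLLR_div hrate hstable hac (hinit s hs) hw

end Rate

end SensorNetwork

theorem mainTheorem7 {L : ℕ} {E : Type*} [MeasurableSpace E] (N : SensorNetwork L E)
    (hrate : ∀ i, 0 < (N.rate i : ℝ))
    (hstable : ∑ i, (N.rate i : ℝ) < (N.success : ℝ))
    (hac : ∀ i, (N.post i : Measure E) ≪ (N.pre i : Measure E)) :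
    (∃! π : Measure (Fin L → ℕ), N.IsStationary π) ∧
    (∀ π : Measure (Fin L → ℕ), N.IsStationary π →
      (π.prod N.slotLaw).real (SensorNetwork.received L) = ∑ i, (N.rate i : ℝ) ∧
      ∀ i, ((π.prod N.slotLaw)[|SensorNetwork.received L]).real (SensorNetwork.receivedFrom i) =
        (N.rate i : ℝ) / ∑ j, (N.rate j : ℝ)) ∧
    (∀ (q : Fin L → ℕ) (init : PMF (Fin L → Finset ℤ)),
      (∀ s ∈ init.support, ∀ i, (s i).card = q i ∧ ∀ t ∈ s i, t ≤ 0) →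
      (∀ n, N.obsLaw init 0 n ≪ N.obsLaw init ⊤ n) ∧
      ∀ᵐ ω ∂(N.law init 0),
        Tendsto (fun n : ℕ => ((N.logLR init 0 n ω / n : ℝ) : EReal)) atTop
          (𝓝 ((∑ i, ENNReal.ofReal (N.rate i) *
            klDiv (N.post i : Measure E) (N.pre i : Measure E) : ℝ≥0∞) : EReal))) := by
  refine ⟨N.existsUnique_isStationary hstable, fun π hπ =>
    ⟨N.measureReal_received hπ, fun i => N.cond_received_receivedFrom hπ i⟩,
    fun q init hq => ?_⟩
  have hinit : ∀ s ∈ init.support, ∀ i, ∀ t ∈ s i, t ≤ 0 := fun s hs i => (hq s hs i).2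
  refine ⟨fun n => ?_, ?_⟩
  · rw [N.obsLaw_zero_eq_withDensity hac hinit n]
    exact withDensity_absolutelyContinuous _ _
  · filter_upwards [N.law_ae_tendsto_sum_slotLLR_div hrate hstable hac hinit,
      ae_all_iff.2 (N.logLR_ae_eq_sum hac hinit)] with ω h1 h2
    simpa only [h2] using h1
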